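/- **Setting.** Let $x\in\mathbb R^{n_x}$, $w\in\mathbb R^{n_w}$, $z\in\mathbb R^{n_z}$ be jointly Gaussian random vectors with zero mean and positive definite joint covariance matrix. Write $V_{ab}=\mathbb E\{ab^\top\}$. A sender observes $(x,w,z)$ and draws a message $y\in\mathbb R^{n_y}$ from a conditional probability distribution (Markov kernel) $\gamma(\cdot\mid x,w,z)$; let $\Gamma$ be either the set of all such policies, or the set of those that do not depend on $z$, i.e. $\gamma(\cdot\mid x,w)$. A receiver draws an estimate $\hat x$ of $x$ from a Markov kernel in the set $\Psi$ of kernels from $(y,z)$ to $\mathbb R^{n_x}$, and a malicious agent draws an estimate $\hat w$ of $w$ from a Markov kernel in the set $\Phi$ of kernels from $(y,z)$ to $\mathbb R^{n_w}$. Fix the privacy ratio $\delta\ge 0$. A triple $(\psi^*,\phi^*,\gamma^*)$ with maps $\psi^*:\Gamma\to\Psi$, $\phi^*:\Gamma\to\Phi$ and $\gamma^*\in\Gamma$ is an *equilibrium* if - $\psi^*$ minimizes $\mathbb E\|x-\hat x\|_2^2$ over all maps $\psi:\Gamma\to\Psi$ when the sender uses $\gamma^*$ and the receiver uses $\psi(\gamma^*)$;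 - $\phi^*$ minimizes $\mathbb E\|w-\hat w\|_2^2$ over all maps $\phi:\Gamma\to\Phi$ when the sender uses $\gamma^*$ and the malicious agent uses $\phi(\gamma^*)$; - these two minimal errors are finite, and $\gamma^*$ minimizes $\mathbb E\|x-\hat x\|_2^2-\delta\,\mathbb E\|w-\hat w\|_2^2$ over all $\gamma\in\Gamma$ when the sender, the receiver and the malicious agent use $\gamma$, $\psi^*(\gamma)$ and $\phi^*(\gamma)$. Put $$\Xi=\begin{bmatrix}V_{xx}&V_{xw}\\V_{wx}&V_{ww}\end{bmatrix}-\begin{bmatrix}V_{xz}\\V_{wz}\end{bmatrix}V_{zz}^{-1}\begin{bmatrix}V_{zx}&V_{zw}\end{bmatrix}$$ and consider the quadratic program over $K=[K_x\;K_w]\in\mathbb R^{n_y\times(n_x+n_w)}$ $$\min_K\ \operatorname{tr}\Big(K\,\Xi\begin{bmatrix}-I&0\\0&\delta I\end{bmatrix}\Xi\,K^\top\Big)\quad\text{subject to}\quad K\,\Xi\,K^\top\le I, \tag{QP}$$ where $\le$ is the order of symmetric matrices by positive semidefiniteness of the difference. **Theorem.** For every $\delta\ge0$, (QP) has a minimizer,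 and there are maps $\psi^*:\Gamma\to\Psi$ and $\phi^*:\Gamma\to\Phi$ with the following properties. 1. For every $\gamma\in\Gamma$ under which $\mathbb E\|y\|_2^2<\infty$, the estimates drawn from $\psi^*(\gamma)$ and $\phi^*(\gamma)$ are, with probability one, the linear least-mean-square estimates of $x$ and $w$ from $(y,z)$: $\hat x=A\begin{bmatrix}y\\z\end{bmatrix}$ and $\hat w=B\begin{bmatrix}y\\z\end{bmatrix}$ for matrices with $$A\begin{bmatrix}V_{yy}&V_{yz}\\V_{zy}&V_{zz}\end{bmatrix}=\begin{bmatrix}V_{xy}&V_{xz}\end{bmatrix},\qquad B\begin{bmatrix}V_{yy}&V_{yz}\\V_{zy}&V_{zz}\end{bmatrix}=\begin{bmatrix}V_{wy}&V_{wz}\end{bmatrix};$$ so $A=\begin{bmatrix}V_{xy}&V_{xz}\end{bmatrix}\begin{bmatrix}V_{yy}&V_{yz}\\V_{zy}&V_{zz}\end{bmatrix}^{-1}$ and $B=\begin{bmatrix}V_{wy}&V_{wz}\end{bmatrix}\begin{bmatrix}V_{yy}&V_{yz}\\V_{zy}&V_{zz}\end{bmatrix}^{-1}$ whenever the inverse exists.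 2. Let $K=[K_x\;K_w]$ be any minimizer of (QP), and let $\gamma^*$ be the policy $$y=K_xx+K_ww+v,$$ where $v$ is a Gaussian vector independent of $(x,w,z)$ with mean zero and covariance $V_{vv}=I-K\,\Xi\,K^\top$. Then $(\psi^*,\phi^*,\gamma^*)$ is an equilibrium. Under $\gamma^*$, $\mathbb E\|y\|_2^2<\infty$ and $\begin{bmatrix}V_{yy}&V_{yz}\\V_{zy}&V_{zz}\end{bmatrix}$ is invertible, so that $\hat x$ and $\hat w$ are given with probability one by the formulas with the inverse. 3. If $n_x,n_y\ge1$, each of these equilibria is informative: the receiver's error $\mathbb E\|x-\hat x\|_2^2$ is strictly smaller than that of every (possibly randomized) estimator of $x$ based on $z$ alone. 4. For every $\kappa\in\mathbb R^{n_y\times n_y}$ with $\det\kappa\ne0$, $(\psi^*,\phi^*,\kappa\gamma^*)$ is again an equilibrium, where $\kappa\gamma^*$ sends $\kappa y$ whenever $\gamma^*$ sends $y$. -/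

import Mathlib

open MeasureTheory ProbabilityTheory
open scoped ENNReal

namespace PrivacyGame

noncomputable section

/-- Euclidean space `ℝⁿ`. -/
abbrev Vec (n : ℕ) : Type := EuclideanSpace ℝ (Fin n)

/-- The realizations of the triple `(x, w, z)`: state, private information, side information. -/
abbrev State (nx nw nz : ℕ) : Type := Vec nx × Vec nw × Vec nz

/-- A randomized policy: a conditional probability distribution on the actions `B` given the
observation `A`. -/
structure Policy (A B : Type*) [MeasurableSpace A] [MeasurableSpace B] where
  kernel : Kernel A B
  isMarkov : IsMarkovKernel kernel

attribute [instance] Policy.isMarkov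

/-- Sender policies `γ(dy | x, w, z)`. -/
abbrev Sender (nx nw nz ny : ℕ) : Type := Policy (State nx nw nz) (Vec ny)

/-- Estimators `η(de | y, z)` with values in `ℝⁿ`; the receiver has `n = nx`, the malicious agent
has `n = nw`. -/
abbrev Estimator (ny nz n : ℕ) : Type := Policy (Vec ny × Vec nz) (Vec n)

variable {nx nw nz ny n : ℕ}

/-- The sender policies of the form `γ(dy | x, w)`. -/
def withoutSideInformation (nx nw nz ny : ℕ) : Set (Sender nx nw nz ny) :=
  {γ | ∃ γ₀ : Policy (Vec nx × Vec nw) (Vec ny), ∀ x w z, γ.kernel (x, w, z) = γ₀.kernel (x, w)}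

/-- The expected squared error `E‖t - e‖²`, where `t` is the target (`x` or `w`), `(x, w, z)` has
law `μ`, the message `y` is drawn from `γ(· | x, w, z)`, and `e` is drawn from `η(· | y, z)`. -/
def estimationCost (μ : Measure (State nx nw nz)) (target : State nx nw nz → Vec n)
    (γ : Sender nx nw nz ny) (η : Estimator ny nz n) : ℝ≥0∞ :=
  ∫⁻ s, ∫⁻ y, ∫⁻ e, ‖target s - e‖ₑ ^ 2 ∂(η.kernel (y, s.2.2)) ∂(γ.kernel s) ∂μ

def receiverCost (μ : Measure (State nx nw nz)) (γ : Sender nx nw nz ny)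
    (η : Estimator ny nz nx) : ℝ≥0∞ :=
  estimationCost μ (fun s => s.1) γ η

def maliciousCost (μ : Measure (State nx nw nz)) (γ : Sender nx nw nz ny)
    (η : Estimator ny nz nw) : ℝ≥0∞ :=
  estimationCost μ (fun s => s.2.1) γ η

/-- The sender's cost `E‖x - x̂‖² - δ E‖w - ŵ‖²`. The indeterminate case `⊤ - ⊤` has the value `⊥`,
so that a deviation with an indeterminate cost would count as profitable. -/
def senderCost (μ : Measure (State nx nw nz)) (δ : ℝ) (γ : Sender nx nw nz ny)
    (η : Estimator ny nz nx) (θ : Estimator ny nz nw) : EReal :=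
  (receiverCost μ γ η : EReal) - (δ : EReal) * (maliciousCost μ γ θ : EReal)

/-- Equilibrium of the privacy game with privacy ratio `δ` in which the sender chooses from `Γ`.
The receiver and the malicious agent choose maps from sender policies to estimators. Only the
values of `ψ` and `φ` on `Γ` matter. -/
structure IsEquilibrium (μ : Measure (State nx nw nz)) (δ : ℝ) (Γ : Set (Sender nx nw nz ny))
    (ψ : Sender nx nw nz ny → Estimator ny nz nx) (φ : Sender nx nw nz ny → Estimator ny nz nw)
    (γ : Sender nx nw nz ny) : Prop where
  mem : γ ∈ Γ
  receiverCost_ne_top : receiverCost μ γ (ψ γ) ≠ ⊤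
  maliciousCost_ne_top : maliciousCost μ γ (φ γ) ≠ ⊤
  receiver_optimal : ∀ ψ' : Sender nx nw nz ny → Estimator ny nz nx,
    receiverCost μ γ (ψ γ) ≤ receiverCost μ γ (ψ' γ)
  malicious_optimal : ∀ φ' : Sender nx nw nz ny → Estimator ny nz nw,
    maliciousCost μ γ (φ γ) ≤ maliciousCost μ γ (φ' γ)
  sender_optimal : ∀ γ' ∈ Γ,
    senderCost μ δ γ (ψ γ) (φ γ) ≤ senderCost μ δ γ' (ψ γ') (φ γ')

/-- The message carries information about the state: with it, the receiver's error is strictly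
smaller than that of every estimator of `x` that is based on `z` alone. -/
def IsInformative (μ : Measure (State nx nw nz)) (ψ : Sender nx nw nz ny → Estimator ny nz nx)
    (γ : Sender nx nw nz ny) : Prop :=
  ∀ η : Policy (Vec nz) (Vec nx),
    receiverCost μ γ (ψ γ) < ∫⁻ s, ∫⁻ e, ‖s.1 - e‖ₑ ^ 2 ∂(η.kernel s.2.2) ∂μ

/-- The matrix `V_{ab} = E[a bᵀ]`. -/
def secondMoment {Ω ι κ : Type*} [MeasurableSpace Ω] (P : Measure Ω) (a : Ω → ι → ℝ)
    (b : Ω → κ → ℝ) : Matrix ι κ ℝ :=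
  Matrix.of fun i j => ∫ ω, a ω i * b ω j ∂P

/-- The stacked vector `(x, w)`. -/
def vecXW (s : State nx nw nz) : Fin nx ⊕ Fin nw → ℝ := Sum.elim s.1 s.2.1

/-- The side information `z` as a coordinate vector. -/
def vecZ (s : State nx nw nz) : Fin nz → ℝ := s.2.2

/-- The stacked vector `(x, w, z)`. -/
def vecXWZ (s : State nx nw nz) : (Fin nx ⊕ Fin nw) ⊕ Fin nz → ℝ := Sum.elim (vecXW s) (vecZ s)

/-- The stacked vector `(y, z)`. -/
def vecYZ (y : Vec ny) (z : Vec nz) : Fin ny ⊕ Fin nz → ℝ := Sum.elim y z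

/-- The joint law of `((x, w, z), y)` under the sender policy `γ`. -/
def jointLaw (μ : Measure (State nx nw nz)) (γ : Sender nx nw nz ny) :
    Measure (State nx nw nz × Vec ny) :=
  μ ⊗ₘ γ.kernel

/-- `E‖y‖² < ∞` under the sender policy `γ`. -/
def HasFiniteSecondMoment (μ : Measure (State nx nw nz)) (γ : Sender nx nw nz ny) : Prop :=
  ∫⁻ p, ‖p.2‖ₑ ^ 2 ∂(jointLaw μ γ) < ⊤

/-- The block matrix `[[V_yy, V_yz], [V_zy, V_zz]]`. -/
def obsMoment (μ : Measure (State nx nw nz)) (γ : Sender nx nw nz ny) :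
    Matrix (Fin ny ⊕ Fin nz) (Fin ny ⊕ Fin nz) ℝ :=
  secondMoment (jointLaw μ γ) (fun p => vecYZ p.2 p.1.2.2) (fun p => vecYZ p.2 p.1.2.2)

/-- The block matrix `[V_ty, V_tz]` for the target `t` (`x` or `w`). -/
def crossMoment (μ : Measure (State nx nw nz)) (target : State nx nw nz → Vec n)
    (γ : Sender nx nw nz ny) : Matrix (Fin n) (Fin ny ⊕ Fin nz) ℝ :=
  secondMoment (jointLaw μ γ) (fun p => target p.1) (fun p => vecYZ p.2 p.1.2.2)

/-- Under the sender policy `γ`, the estimate drawn from `η(· | y, z)` is `A (y, z)` with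
probability one. -/
def UsesGain (μ : Measure (State nx nw nz)) (γ : Sender nx nw nz ny) (η : Estimator ny nz n)
    (A : Matrix (Fin n) (Fin ny ⊕ Fin nz) ℝ) : Prop :=
  ∀ᵐ p ∂(jointLaw μ γ), ∀ᵐ e ∂(η.kernel (p.2, p.1.2.2)),
    e = WithLp.toLp 2 (A.mulVec (vecYZ p.2 p.1.2.2))

/-- Under the sender policy `γ`, the estimator `η` is the linear least-mean-square estimator of the
target from `(y, z)`: with probability one the estimate is `A (y, z)`, where `A` satisfies the
normal equations, and `A = [V_ty, V_tz] [[V_yy, V_yz], [V_zy, V_zz]]⁻¹` if the inverse exists. -/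
def IsLinearLMS (μ : Measure (State nx nw nz)) (target : State nx nw nz → Vec n)
    (γ : Sender nx nw nz ny) (η : Estimator ny nz n) : Prop :=
  ∃ A : Matrix (Fin n) (Fin ny ⊕ Fin nz) ℝ,
    A * obsMoment μ γ = crossMoment μ target γ ∧
    (IsUnit (obsMoment μ γ).det → A = crossMoment μ target γ * (obsMoment μ γ)⁻¹) ∧
    UsesGain μ γ η A

/-- The Schur complement `Ξ = V_{(x,w)(x,w)} - V_{(x,w)z} V_zz⁻¹ V_{z(x,w)}`. -/
def schurCov (μ : Measure (State nx nw nz)) : Matrix (Fin nx ⊕ Fin nw) (Fin nx ⊕ Fin nw) ℝ :=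
  secondMoment μ vecXW vecXW -
    secondMoment μ vecXW vecZ * (secondMoment μ vecZ vecZ)⁻¹ * secondMoment μ vecZ vecXW

/-- The gains `K = [K_x, K_w]` with `K Ξ Kᵀ ≤ I` in the Loewner order. -/
def feasible (μ : Measure (State nx nw nz)) (ny : ℕ) :
    Set (Matrix (Fin ny) (Fin nx ⊕ Fin nw) ℝ) :=
  {K | (1 - K * schurCov μ * K.transpose).PosSemidef}

/-- The objective `tr(K Ξ diag(-I, δ I) Ξ Kᵀ)`. -/
def objective (μ : Measure (State nx nw nz)) (δ : ℝ)
    (K : Matrix (Fin ny) (Fin nx ⊕ Fin nw) ℝ) : ℝ :=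
  (K * schurCov μ *
    Matrix.fromBlocks (-(1 : Matrix (Fin nx) (Fin nx) ℝ)) 0 0 (δ • (1 : Matrix (Fin nw) (Fin nw) ℝ)) *
    schurCov μ * K.transpose).trace

/-- The optimal solutions of the quadratic program. -/
def minimizers (μ : Measure (State nx nw nz)) (δ : ℝ) (ny : ℕ) :
    Set (Matrix (Fin ny) (Fin nx ⊕ Fin nw) ℝ) :=
  {K | K ∈ feasible μ ny ∧ ∀ K' ∈ feasible μ ny, objective μ δ K ≤ objective μ δ K'}

/-- The sender policy `y = K_x x + K_w w + v`, where `v` is independent of `(x, w, z)` with the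
centred Gaussian law of covariance `I - K Ξ Kᵀ`. -/
def gaussianSender (μ : Measure (State nx nw nz)) (K : Matrix (Fin ny) (Fin nx ⊕ Fin nw) ℝ) :
    Sender nx nw nz ny where
  kernel :=
    (Kernel.id ×ₖ Kernel.const (State nx nw nz)
        (multivariateGaussian (0 : Vec ny) (1 - K * schurCov μ * K.transpose))).map
      fun p => K.toCols₁.toEuclideanLin p.1.1 + K.toCols₂.toEuclideanLin p.1.2.1 + p.2
  isMarkov := by
    refine Kernel.IsMarkovKernel.map _ ?_
    have h₁ : Continuous K.toCols₁.toEuclideanLin := LinearMap.continuous_of_finiteDimensional _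
    have h₂ : Continuous K.toCols₂.toEuclideanLin := LinearMap.continuous_of_finiteDimensional _
    fun_prop

/-- The policy `κγ`, which sends `κ y` whenever `γ` sends `y`. -/
def Policy.scale {A : Type*} [MeasurableSpace A] (κ : Matrix (Fin ny) (Fin ny) ℝ)
    (γ : Policy A (Vec ny)) : Policy A (Vec ny) where
  kernel := γ.kernel.map κ.toEuclideanLin
  isMarkov := by
    refine Kernel.IsMarkovKernel.map _ ?_
    have h : Continuous κ.toEuclideanLin := LinearMap.continuous_of_finiteDimensional _
    fun_prop

end

end PrivacyGame

open PrivacyGame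

/-! Let `ψ*` and `φ*` answer every policy with the linear least-mean-square estimates, or with the
best linear estimates from `z` alone if `E‖y‖² = ∞`. The optimality of the two agents is required
only at `γ*`; there the joint law is centred Gaussian, the estimation error is independent of `(y,
z)`, and no randomized estimator does better (`lintegral_error_le_estimationCost`).

Against linear replies the sender's cost depends on second moments only, whatever the law of the
message. With `S` the covariance of `y` given `z` (the Schur complement of `V_zz`) and `G` the gain
on `y`, the error covariance of `(x, w)` is `Ξ - G S Gᵀ`. It is positive semidefinite, and this is
the only constraint: reading one block matrix through both of its Schur complements turns `G S Gᵀ ≤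
Ξ` into `G S Gᵀ = Ξ Kᵀ K Ξ` with `K Ξ Kᵀ ≤ I` (`exists_gain_of_reduction`). So each policy costs a
constant plus the objective at some feasible `K` (`exists_hasErrorCov`,
`HasErrorCov.senderCost_eq`).

Conversely, in `y = K (x, w) + v` the noise fills the covariance of `y` given `z` up to `I`, and the
reduction is exactly `Ξ Kᵀ K Ξ` (`hasErrorCov_gaussianSender`). A minimizer of the quadratic program
is thus optimal for the sender. Minimizers exist by compactness. They are informative because
revealing something about one coordinate of `x` already makes the objective negative. An invertible
`κ` can be undone by the estimators, so it changes no error. -/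

namespace PrivacyGame

/-! ### Second-moment matrices and the normal equations -/

section SecondMoment

variable {Ω Ω' ι κ τ : Type*} [MeasurableSpace Ω] [MeasurableSpace Ω'] {P : Measure Ω}

lemma secondMoment_transpose (a : Ω → ι → ℝ) (b : Ω → κ → ℝ) :
    (secondMoment P a b).transpose = secondMoment P b a := by
  ext i j
  simp [secondMoment, mul_comm]

lemma secondMoment_map {f : Ω → Ω'} (hf : Measurable f) {a : Ω' → ι → ℝ} {b : Ω' → κ → ℝ}
    (ha : ∀ i, Measurable fun ω => a ω i) (hb : ∀ j, Measurable fun ω => b ω j) :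
    secondMoment (P.map f) a b = secondMoment P (fun ω => a (f ω)) (fun ω => b (f ω)) := by
  ext i j
  exact integral_map hf.aemeasurable ((ha i).mul (hb j)).aestronglyMeasurable

lemma secondMoment_sumElim_left {ι' : Type*} (a : Ω → ι → ℝ) (a' : Ω → ι' → ℝ) (b : Ω → κ → ℝ) :
    secondMoment P (fun ω => Sum.elim (a ω) (a' ω)) b =
      Matrix.fromRows (secondMoment P a b) (secondMoment P a' b) := by
  ext (i | i) j <;> rfl

lemma secondMoment_sumElim_right {κ' : Type*} (a : Ω → ι → ℝ) (b : Ω → κ → ℝ) (b' : Ω → κ' → ℝ) :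
    secondMoment P a (fun ω => Sum.elim (b ω) (b' ω)) =
      Matrix.fromCols (secondMoment P a b) (secondMoment P a b') := by
  ext i (j | j) <;> rfl

lemma secondMoment_sumElim {ι' κ' : Type*} (a : Ω → ι → ℝ) (a' : Ω → ι' → ℝ)
    (b : Ω → κ → ℝ) (b' : Ω → κ' → ℝ) :
    secondMoment P (fun ω => Sum.elim (a ω) (a' ω)) (fun ω => Sum.elim (b ω) (b' ω)) =
      Matrix.fromBlocks (secondMoment P a b) (secondMoment P a b')
        (secondMoment P a' b) (secondMoment P a' b') := by
  ext (i | i) (j | j) <;> rfl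

lemma secondMoment_add_left {a a' : Ω → ι → ℝ} {b : Ω → κ → ℝ}
    (ha : ∀ i, MemLp (fun ω => a ω i) 2 P) (ha' : ∀ i, MemLp (fun ω => a' ω i) 2 P)
    (hb : ∀ j, MemLp (fun ω => b ω j) 2 P) :
    secondMoment P (fun ω => a ω + a' ω) b = secondMoment P a b + secondMoment P a' b := by
  ext i j
  simp only [secondMoment, Matrix.of_apply, Matrix.add_apply, Pi.add_apply, add_mul]
  exact integral_add ((ha i).integrable_mul (hb j)) ((ha' i).integrable_mul (hb j))

lemma secondMoment_sub_left {a a' : Ω → ι → ℝ} {b : Ω → κ → ℝ}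
    (ha : ∀ i, MemLp (fun ω => a ω i) 2 P) (ha' : ∀ i, MemLp (fun ω => a' ω i) 2 P)
    (hb : ∀ j, MemLp (fun ω => b ω j) 2 P) :
    secondMoment P (fun ω => a ω - a' ω) b = secondMoment P a b - secondMoment P a' b := by
  ext i j
  simp only [secondMoment, Matrix.of_apply, Matrix.sub_apply, Pi.sub_apply, sub_mul]
  exact integral_sub ((ha i).integrable_mul (hb j)) ((ha' i).integrable_mul (hb j))

lemma memLp_mulVec [Fintype ι] (A : Matrix τ ι ℝ) {a : Ω → ι → ℝ}
    (ha : ∀ i, MemLp (fun ω => a ω i) 2 P) (t : τ) :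
    MemLp (fun ω => A.mulVec (a ω) t) 2 P := by
  simp only [Matrix.mulVec, dotProduct]
  exact memLp_finsetSum _ fun i _ => (ha i).const_mul _

lemma secondMoment_mulVec_left [Fintype ι] (A : Matrix τ ι ℝ) {a : Ω → ι → ℝ} {b : Ω → κ → ℝ}
    (ha : ∀ i, MemLp (fun ω => a ω i) 2 P) (hb : ∀ j, MemLp (fun ω => b ω j) 2 P) :
    secondMoment P (fun ω => A.mulVec (a ω)) b = A * secondMoment P a b := by
  ext t j
  simp only [secondMoment, Matrix.of_apply, Matrix.mul_apply, Matrix.mulVec, dotProduct,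
    Finset.sum_mul]
  rw [integral_finsetSum]
  · simp only [mul_assoc, integral_const_mul]
  · intro i _
    simp only [mul_assoc]
    exact ((ha i).integrable_mul (hb j)).const_mul _

lemma secondMoment_add_right {a : Ω → ι → ℝ} {b b' : Ω → κ → ℝ}
    (ha : ∀ i, MemLp (fun ω => a ω i) 2 P) (hb : ∀ j, MemLp (fun ω => b ω j) 2 P)
    (hb' : ∀ j, MemLp (fun ω => b' ω j) 2 P) :
    secondMoment P a (fun ω => b ω + b' ω) = secondMoment P a b + secondMoment P a b' := by
  rw [← secondMoment_transpose, secondMoment_add_left hb hb' ha, Matrix.transpose_add,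
    secondMoment_transpose, secondMoment_transpose]

lemma secondMoment_sub_right {a : Ω → ι → ℝ} {b b' : Ω → κ → ℝ}
    (ha : ∀ i, MemLp (fun ω => a ω i) 2 P) (hb : ∀ j, MemLp (fun ω => b ω j) 2 P)
    (hb' : ∀ j, MemLp (fun ω => b' ω j) 2 P) :
    secondMoment P a (fun ω => b ω - b' ω) = secondMoment P a b - secondMoment P a b' := by
  rw [← secondMoment_transpose, secondMoment_sub_left hb hb' ha, Matrix.transpose_sub,
    secondMoment_transpose, secondMoment_transpose]

lemma secondMoment_mulVec_right [Fintype κ] (A : Matrix τ κ ℝ) {a : Ω → ι → ℝ} {b : Ω → κ → ℝ}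
    (ha : ∀ i, MemLp (fun ω => a ω i) 2 P) (hb : ∀ j, MemLp (fun ω => b ω j) 2 P) :
    secondMoment P a (fun ω => A.mulVec (b ω)) = secondMoment P a b * A.transpose := by
  rw [← secondMoment_transpose, secondMoment_mulVec_left A hb ha, Matrix.transpose_mul,
    secondMoment_transpose]

lemma dotProduct_secondMoment_mulVec [Fintype ι] {a : Ω → ι → ℝ}
    (ha : ∀ i, MemLp (fun ω => a ω i) 2 P) (v : ι → ℝ) :
    v ⬝ᵥ (secondMoment P a a).mulVec v = ∫ ω, (v ⬝ᵥ a ω) ^ 2 ∂P := by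
  -- As a one-row matrix, `v` falls under the rules for linear images, and the quadratic form
  -- becomes a 1×1 second moment.
  have h := secondMoment_mulVec_left (Matrix.replicateRow Unit v) ha
    (memLp_mulVec (Matrix.replicateRow Unit v) ha)
  rw [secondMoment_mulVec_right _ ha ha] at h
  have h' := congrFun (congrFun h ()) ()
  rw [← Matrix.mul_assoc, Matrix.mul_assoc, Matrix.mul_apply] at h'
  have e : ∫ ω, (v ⬝ᵥ a ω) ^ 2 ∂P = secondMoment P
      (fun ω => (Matrix.replicateRow Unit v).mulVec (a ω))
      (fun ω => (Matrix.replicateRow Unit v).mulVec (a ω)) () () := by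
    simp only [secondMoment, Matrix.of_apply, pow_two]
    rfl
  rw [e, h']
  rfl

lemma secondMoment_posSemidef [Fintype ι] {a : Ω → ι → ℝ}
    (ha : ∀ i, MemLp (fun ω => a ω i) 2 P) : (secondMoment P a a).PosSemidef := by
  refine Matrix.PosSemidef.of_dotProduct_mulVec_nonneg ?_ fun v => ?_
  · rw [Matrix.IsHermitian, Matrix.conjTranspose_eq_transpose_of_trivial, secondMoment_transpose]
  · rw [star_trivial, dotProduct_secondMoment_mulVec ha]
    exact integral_nonneg fun ω => sq_nonneg _

/-- The normal equations of linear least-mean-square estimation are always solvable. -/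
lemma exists_mul_secondMoment_eq [Fintype ι] [Fintype κ] {a : Ω → ι → ℝ} {b : Ω → κ → ℝ}
    (ha : ∀ i, MemLp (fun ω => a ω i) 2 P) (hb : ∀ j, MemLp (fun ω => b ω j) 2 P) :
    ∃ A : Matrix ι κ ℝ, A * secondMoment P b b = secondMoment P a b := by
  classical
  -- If `V_bb v = 0`, then `E (v ⬝ b)² = 0`, so `v ⬝ b = 0` almost surely and `V_ab v = E[a (v ⬝ b)]
  -- = 0`.
  have hker : LinearMap.ker (secondMoment P b b).mulVecLin ≤
      LinearMap.ker (secondMoment P a b).mulVecLin := by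
    intro v hv
    rw [LinearMap.mem_ker, Matrix.mulVecLin_apply] at hv ⊢
    have h0 : ∫ ω, (v ⬝ᵥ b ω) ^ 2 ∂P = 0 := by
      rw [← dotProduct_secondMoment_mulVec hb, hv, dotProduct_zero]
    have hvb : MemLp (fun ω => v ⬝ᵥ b ω) 2 P := by
      simp only [dotProduct]
      exact memLp_finsetSum _ fun i _ => (hb i).const_mul _
    rw [integral_eq_zero_iff_of_nonneg (fun ω => sq_nonneg _) hvb.integrable_sq] at h0
    have h1 := secondMoment_mulVec_right (Matrix.replicateRow Unit v) ha hb
    ext i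
    have h2 := congrFun (congrFun h1 i) ()
    rw [Matrix.mul_apply] at h2
    change _ = (secondMoment P a b).mulVec v i at h2
    rw [← h2]
    refine integral_eq_zero_of_ae ?_
    filter_upwards [h0] with ω hω
    have : v ⬝ᵥ b ω = 0 := by simpa using hω
    change a ω i * (v ⬝ᵥ b ω) = 0
    rw [this, mul_zero]
  -- By the kernel inclusion `V_ab` factors through `V_bb`: compose it with a section of `V_bb` over
  -- its range and extend to the whole space.
  obtain ⟨g, hg⟩ : ∃ g, g ∘ₗ (secondMoment P b b).mulVecLin = (secondMoment P a b).mulVecLin := by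
    obtain ⟨h, hh⟩ := LinearMap.exists_rightInverse_of_surjective
      (secondMoment P b b).mulVecLin.rangeRestrict (LinearMap.range_rangeRestrict _)
    obtain ⟨g, hg⟩ := LinearMap.exists_extend ((secondMoment P a b).mulVecLin ∘ₗ h)
    refine ⟨g, LinearMap.ext fun v => ?_⟩
    have e1 : g ((secondMoment P b b).mulVecLin v) =
        (secondMoment P a b).mulVecLin (h ((secondMoment P b b).mulVecLin.rangeRestrict v)) :=
      LinearMap.congr_fun hg ((secondMoment P b b).mulVecLin.rangeRestrict v)
    rw [LinearMap.comp_apply, e1, ← sub_eq_zero, ← map_sub]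
    refine hker ?_
    rw [LinearMap.mem_ker, map_sub, sub_eq_zero]
    exact congrArg Subtype.val
      (LinearMap.congr_fun hh ((secondMoment P b b).mulVecLin.rangeRestrict v))
  refine ⟨LinearMap.toMatrix' g, ?_⟩
  have := congrArg LinearMap.toMatrix' hg
  rw [LinearMap.toMatrix'_comp] at this
  simpa only [← Matrix.toLin'_apply', LinearMap.toMatrix'_toLin'] using this

/-- The estimation error is uncorrelated with the observation. -/
lemma secondMoment_error_left [Fintype κ] {a : Ω → ι → ℝ} {b : Ω → κ → ℝ}
    (ha : ∀ i, MemLp (fun ω => a ω i) 2 P) (hb : ∀ j, MemLp (fun ω => b ω j) 2 P)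
    {A : Matrix ι κ ℝ} (hA : A * secondMoment P b b = secondMoment P a b) :
    secondMoment P (fun ω => a ω - A.mulVec (b ω)) b = 0 := by
  rw [secondMoment_sub_left ha (memLp_mulVec A hb) hb, secondMoment_mulVec_left A hb hb, hA,
    sub_self]

/-- By orthogonality of the error to `b`, one of the two error factors may be replaced by `a`. -/
lemma secondMoment_error [Fintype κ] {a : Ω → ι → ℝ} {b : Ω → κ → ℝ}
    (ha : ∀ i, MemLp (fun ω => a ω i) 2 P) (hb : ∀ j, MemLp (fun ω => b ω j) 2 P)
    {A : Matrix ι κ ℝ} (hA : A * secondMoment P b b = secondMoment P a b) :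
    secondMoment P (fun ω => a ω - A.mulVec (b ω)) (fun ω => a ω - A.mulVec (b ω)) =
      secondMoment P a a - A * secondMoment P b a := by
  have he : ∀ i, MemLp (fun ω => (a ω - A.mulVec (b ω)) i) 2 P :=
    fun i => (ha i).sub (memLp_mulVec A hb i)
  rw [secondMoment_sub_right he ha (memLp_mulVec A hb), secondMoment_mulVec_right A he hb,
    secondMoment_error_left ha hb hA, Matrix.zero_mul, sub_zero,
    secondMoment_sub_left ha (memLp_mulVec A hb) ha, secondMoment_mulVec_left A hb ha]

lemma lintegral_enorm_sq_eq [Fintype ι] {a : Ω → EuclideanSpace ℝ ι}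
    (ha : ∀ i, MemLp (fun ω => a ω i) 2 P) :
    ∫⁻ ω, ‖a ω‖ₑ ^ 2 ∂P =
      ENNReal.ofReal (secondMoment P (fun ω => (a ω : ι → ℝ)) (fun ω => (a ω : ι → ℝ))).trace := by
  have h (ω : Ω) : ‖a ω‖ₑ ^ 2 = ENNReal.ofReal (∑ i, a ω i * a ω i) := by
    rw [← ofReal_norm, ← ENNReal.ofReal_pow (norm_nonneg _),
      EuclideanSpace.real_norm_sq_eq]
    simp only [pow_two]
  have hi (i : ι) : Integrable (fun ω => a ω i * a ω i) P := (ha i).integrable_mul (ha i)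
  simp only [h]
  rw [← ofReal_integral_eq_lintegral_ofReal (integrable_finsetSum _ fun i _ => hi i)
    (Filter.Eventually.of_forall fun ω => Finset.sum_nonneg fun i _ => mul_self_nonneg _),
    integral_finsetSum _ fun i _ => hi i]
  rfl

end SecondMoment

/-! ### Schur complements -/

section LinearAlgebra

open Matrix
open scoped MatrixOrder

variable {m p : Type*} [Fintype m] [Fintype p] [DecidableEq m] [DecidableEq p]

lemma exists_transpose_mul_self_eq {S : Matrix m m ℝ} (hS : S.PosSemidef) :
    ∃ B : Matrix m m ℝ, Bᵀ * B = S := by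
  obtain ⟨B, hB⟩ := CStarAlgebra.nonneg_iff_eq_star_mul_self.mp hS.nonneg
  exact ⟨B, by rw [hB, star_eq_conjTranspose, conjTranspose_eq_transpose_of_trivial]⟩

/-- The Schur complement of a block of a positive definite matrix is positive definite. -/
lemma posDef_schur {A : Matrix m m ℝ} {B : Matrix m p ℝ} {D : Matrix p p ℝ}
    (h : (fromBlocks A B Bᵀ D).PosDef) : D.PosDef ∧ (A - B * D⁻¹ * Bᵀ).PosDef := by
  have hD : D.PosDef := by
    have := h.submatrix (e := (Sum.inr : p → m ⊕ p)) Sum.inr_injective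
    exact this
  refine ⟨hD, ?_⟩
  have : Invertible D := hD.isUnit.invertible
  have hS : (A - B * D⁻¹ * Bᵀ).PosSemidef := by
    have := (PosDef.fromBlocks₂₂ A B hD).mp (by simpa using h.posSemidef)
    simpa using this
  -- A semidefinite matrix is definite once it is invertible, and the determinant of the block
  -- matrix is `det D` times that of the Schur complement.
  rw [hS.posDef_iff_isUnit, isUnit_iff_isUnit_det]
  have hdet := (isUnit_iff_isUnit_det _).mp h.isUnit
  rw [det_fromBlocks₂₂, invOf_eq_nonsing_inv] at hdet
  exact isUnit_of_mul_isUnit_right hdet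

/-- A reduction `G S Gᵀ` of the error covariance `Ξ` is attained by a feasible gain. -/
lemma exists_gain_of_reduction {X : Matrix m m ℝ} (hX : X.PosDef) {S : Matrix p p ℝ}
    (hS : S.PosSemidef) {G : Matrix m p ℝ} (h : (X - G * S * Gᵀ).PosSemidef) :
    ∃ K : Matrix p m ℝ, (1 - K * X * Kᵀ).PosSemidef ∧ X * Kᵀ * K * X = G * S * Gᵀ := by
  obtain ⟨B, rfl⟩ := exists_transpose_mul_self_eq hS
  have hXt : Xᵀ = X := by simpa using hX.isHermitian.eq
  have hu : IsUnit X.det := (isUnit_iff_isUnit_det _).mp hX.isUnit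
  have hXi : (X⁻¹)ᵀ = X⁻¹ := by rw [transpose_nonsing_inv, hXt]
  have : Invertible X := hX.isUnit.invertible
  -- With `S = Bᵀ B`, this gain has `K X = B Gᵀ`, hence `X Kᵀ K X = G S Gᵀ`.
  refine ⟨B * Gᵀ * X⁻¹, ?_, ?_⟩
  -- Eliminating the block `1` leaves `X - G S Gᵀ`; eliminating the block `X` leaves `1 - K X Kᵀ`.
  -- Semidefiniteness of either is equivalent to that of the block matrix.
  · have h1 : (fromBlocks X (G * Bᵀ) (G * Bᵀ)ᴴ (1 : Matrix p p ℝ)).PosSemidef := by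
      have : Invertible (1 : Matrix p p ℝ) := invertibleOne
      rw [PosDef.fromBlocks₂₂ _ _ PosDef.one]
      simpa [Matrix.mul_assoc] using h
    rw [PosDef.fromBlocks₁₁ _ _ hX] at h1
    have e : B * Gᵀ * X⁻¹ * X * (B * Gᵀ * X⁻¹)ᵀ = (G * Bᵀ)ᴴ * X⁻¹ * (G * Bᵀ) := by
      simp only [transpose_mul, transpose_transpose, hXi, conjTranspose_eq_transpose_of_trivial,
        Matrix.mul_assoc, nonsing_inv_mul_cancel_left _ _ hu]
    rwa [e]
  · simp only [transpose_mul, transpose_transpose, hXi, Matrix.mul_assoc,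
      nonsing_inv_mul _ hu, mul_nonsing_inv_cancel_left _ _ hu, Matrix.mul_one]

/-- Elimination of the side information from the normal equations. -/
lemma toCols₁_mul_schur {m p q : Type*} [Fintype p] [Fintype q] [DecidableEq q]
    {A : Matrix m (p ⊕ q) ℝ} {Y : Matrix p p ℝ} {B : Matrix p q ℝ}
    {Z : Matrix q q ℝ} {C : Matrix m p ℝ} {D : Matrix m q ℝ} (hZ : IsUnit Z.det)
    (hA : A * fromBlocks Y B Bᵀ Z = fromCols C D) :
    A.toCols₁ * (Y - B * Z⁻¹ * Bᵀ) = C - D * Z⁻¹ * Bᵀ := by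
  rw [← fromCols_toCols A, fromCols_mul_fromBlocks] at hA
  obtain ⟨h1, h2⟩ := fromCols_inj hA
  rw [← h1, ← h2]
  simp only [Matrix.mul_sub, Matrix.add_mul, Matrix.mul_assoc, mul_nonsing_inv_cancel_left _ _ hZ]
  abel

/-- Separates the error made with the side information alone from the reduction due to the message.
The second column of the normal equations determines the gain on the side information from the gain
`A.toCols₁` on the message. -/
lemma error_eq_schur_sub {m p q : Type*} [Fintype p] [Fintype q] [DecidableEq q]
    {A : Matrix m (p ⊕ q) ℝ} {X : Matrix m m ℝ} {Y : Matrix p p ℝ}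
    {B : Matrix p q ℝ} {Z : Matrix q q ℝ} {C : Matrix m p ℝ} {D : Matrix m q ℝ}
    (hZ : IsUnit Z.det) (hZt : Zᵀ = Z) (hYt : Yᵀ = Y)
    (hA : A * fromBlocks Y B Bᵀ Z = fromCols C D) :
    X - A * (fromCols C D)ᵀ =
      X - D * Z⁻¹ * Dᵀ - A.toCols₁ * (Y - B * Z⁻¹ * Bᵀ) * A.toCols₁ᵀ := by
  have h0 := toCols₁_mul_schur hZ hA
  rw [← fromCols_toCols A, fromCols_mul_fromBlocks] at hA
  obtain ⟨h1, h2⟩ := fromCols_inj hA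
  have hZi : (Z⁻¹)ᵀ = Z⁻¹ := by rw [transpose_nonsing_inv, hZt]
  have h3 : A.toCols₂ = (D - A.toCols₁ * B) * Z⁻¹ := by
    rw [← h2, add_sub_cancel_left, mul_nonsing_inv_cancel_right _ _ hZ]
  have h4 : C * A.toCols₁ᵀ + D * A.toCols₂ᵀ = A * (fromCols C D)ᵀ := by
    have e : A * (fromCols C D)ᵀ = A.toCols₁ * Cᵀ + A.toCols₂ * Dᵀ := by
      conv_lhs => rw [← fromCols_toCols A, transpose_fromCols, fromCols_mul_fromRows]
    rw [e, ← h1, ← h2]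
    simp only [transpose_add, transpose_mul, transpose_transpose, hZt, hYt, Matrix.add_mul,
      Matrix.mul_add, Matrix.mul_assoc]
    abel
  rw [← h4, h0, h3]
  simp only [transpose_mul, transpose_sub, hZi, Matrix.mul_sub, Matrix.sub_mul, Matrix.mul_assoc]
  abel

end LinearAlgebra

/-! ### Existence of minimizers -/

section QuadraticProgram

open Matrix

variable {m p : Type*} [Fintype m] [Fintype p] [DecidableEq p]

/-- Closed, since semidefiniteness is one closed condition on `U` per vector `v`; bounded, since the
diagonal of `1 - U Uᵀ` bounds the norm of each row by 1. -/
lemma isCompact_contractions :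
    IsCompact {U : Matrix p m ℝ | (1 - U * Uᵀ).PosSemidef} := by
  have hc : IsCompact (Set.univ.pi fun _ : p => Set.univ.pi fun _ : m => Set.Icc (-1 : ℝ) 1) :=
    isCompact_univ_pi fun _ => isCompact_univ_pi fun _ => isCompact_Icc
  refine hc.of_isClosed_subset ?_ ?_
  · have : {U : Matrix p m ℝ | (1 - U * Uᵀ).PosSemidef} =
        ⋂ v : p → ℝ, {U | 0 ≤ v ⬝ᵥ (1 - U * Uᵀ) *ᵥ v} := by
      ext U
      simp only [Set.mem_ofPred_eq, Set.mem_iInter]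
      refine ⟨fun h v => by simpa using h.dotProduct_mulVec_nonneg v, fun h => ?_⟩
      refine PosSemidef.of_dotProduct_mulVec_nonneg ?_ fun v => by simpa using h v
      simp [IsHermitian, conjTranspose_eq_transpose_of_trivial]
    rw [this]
    refine isClosed_iInter fun v => isClosed_le continuous_const ?_
    fun_prop
  · intro (U : Matrix p m ℝ) hU i _ j _
    have h := hU.diag_nonneg (i := i)
    rw [Matrix.sub_apply, one_apply_eq, mul_apply] at h
    have h2 : U i j * Uᵀ j i ≤ ∑ k, U i k * Uᵀ k i :=
      Finset.single_le_sum (f := fun k => U i k * Uᵀ k i) (fun k _ => mul_self_nonneg _)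
        (Finset.mem_univ j)
    rw [transpose_apply] at h2
    exact abs_le.mp ((sq_le_one_iff_abs_le_one _).mp (by nlinarith))

/-- A quadratic program under the constraint `K X Kᵀ ≤ 1` has a minimizer. -/
lemma exists_forall_trace_le [DecidableEq m] {X : Matrix m m ℝ} (hX : X.PosDef) (W : Matrix m m ℝ) :
    ∃ K : Matrix p m ℝ, (1 - K * X * Kᵀ).PosSemidef ∧
      ∀ K' : Matrix p m ℝ, (1 - K' * X * K'ᵀ).PosSemidef →
        (K * W * Kᵀ).trace ≤ (K' * W * K'ᵀ).trace := by
  obtain ⟨B, hB⟩ := exists_transpose_mul_self_eq hX.posSemidef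
  have hu : IsUnit B.det := by
    have : IsUnit (Bᵀ * B).det := by rw [hB]; exact (isUnit_iff_isUnit_det _).mp hX.isUnit
    rw [det_mul] at this
    exact isUnit_of_mul_isUnit_right this
  have hut : IsUnit Bᵀ.det := by rwa [det_transpose]
  -- With `X = Bᵀ B`, the substitution `U = K Bᵀ` maps the feasible gains onto the contractions.
  obtain ⟨U, hU, hmin⟩ := (isCompact_contractions (m := m) (p := p)).exists_isMinOn
    ⟨0, by simpa using PosSemidef.one⟩
    (f := fun U => (U * (Bᵀ)⁻¹ * W * (U * (Bᵀ)⁻¹)ᵀ).trace) (by fun_prop)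
  have key (K : Matrix p m ℝ) : K * X * Kᵀ = K * Bᵀ * (K * Bᵀ)ᵀ := by
    rw [← hB]; simp only [transpose_mul, transpose_transpose, Matrix.mul_assoc]
  refine ⟨U * (Bᵀ)⁻¹, ?_, fun K' hK' => ?_⟩
  · rw [key, nonsing_inv_mul_cancel_right _ _ hut]
    exact hU
  · rw [key] at hK'
    have : (U * (Bᵀ)⁻¹ * W * (U * (Bᵀ)⁻¹)ᵀ).trace ≤ (K' * Bᵀ * (Bᵀ)⁻¹ * W *
      (K' * Bᵀ * (Bᵀ)⁻¹)ᵀ).trace := hmin hK'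
    simpa only [mul_nonsing_inv_cancel_right _ _ hut] using this

end QuadraticProgram

/-! ### Linear functions of Gaussian vectors -/

section LinearFunctions

variable {E F : Type*} [NormedAddCommGroup E] [NormedSpace ℝ E] [FiniteDimensional ℝ E]
  [MeasurableSpace E] [BorelSpace E]
  [NormedAddCommGroup F] [NormedSpace ℝ F]

lemma hasGaussianLaw_of_isLinearMap [MeasurableSpace F] [BorelSpace F] {f : E → F}
    (hf : IsLinearMap ℝ f) (P : Measure E) [IsGaussian P] : HasGaussianLaw f P :=
  IsGaussian.hasGaussianLaw_id.map (LinearMap.toContinuousLinearMap (hf.mk' f))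

lemma integral_eq_zero_of_isLinearMap [CompleteSpace F] {f : E → F} (hf : IsLinearMap ℝ f)
    {P : Measure E} [IsGaussian P] (hP : ∫ s, s ∂P = 0) : ∫ s, f s ∂P = 0 := by
  have : ProperSpace E := FiniteDimensional.proper ℝ E
  have h := (LinearMap.toContinuousLinearMap (hf.mk' f)).integral_comp_comm
    (IsGaussian.integrable_id (μ := P))
  simp only [id, hP, map_zero] at h
  exact h

end LinearFunctions

/-! ### Linear estimators and their costs -/

section Estimators

variable {nx nw nz ny n : ℕ} {μ : Measure (State nx nw nz)} {γ : Sender nx nw nz ny}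

lemma measurable_vecYZ (j : Fin ny ⊕ Fin nz) :
    Measurable fun o : Vec ny × Vec nz => vecYZ o.1 o.2 j := by
  rcases j with j | j <;> simp only [vecYZ, Sum.elim_inl, Sum.elim_inr] <;> fun_prop

lemma measurable_gain (A : Matrix (Fin n) (Fin ny ⊕ Fin nz) ℝ) :
    Measurable fun o : Vec ny × Vec nz =>
      (WithLp.toLp 2 (A.mulVec (vecYZ o.1 o.2)) : Vec n) := by
  refine (WithLp.measurable_toLp 2 _).comp (measurable_pi_lambda _ fun i => ?_)
  simp only [Matrix.mulVec, dotProduct]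
  exact Finset.measurable_sum _ fun j _ => (measurable_vecYZ j).const_mul _

lemma vecYZ_isLinearMap : IsLinearMap ℝ fun o : Vec ny × Vec nz => vecYZ o.1 o.2 where
  map_add a b := by ext (j | j) <;> rfl
  map_smul c a := by ext (j | j) <;> rfl

instance [IsProbabilityMeasure μ] : IsProbabilityMeasure (jointLaw μ γ) := by
  unfold jointLaw; infer_instance

lemma map_fst_jointLaw [IsProbabilityMeasure μ] : (jointLaw μ γ).map Prod.fst = μ :=
  Measure.fst_compProd μ γ.kernel

lemma memLp_jointLaw_of_memLp [IsProbabilityMeasure μ] {f : State nx nw nz → ℝ}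
    (hf : MemLp f 2 μ) : MemLp (fun p => f p.1) 2 (jointLaw μ γ) := by
  have h : MemLp f 2 ((jointLaw μ γ).map Prod.fst) := by rwa [map_fst_jointLaw]
  exact h.comp_of_map measurable_fst.aemeasurable

lemma memLp_eval_of_isLinearMap {ι : Type*} [Fintype ι] [IsGaussian μ]
    {f : State nx nw nz → ι → ℝ} (hf : IsLinearMap ℝ f) (i : ι) :
    MemLp (fun s => f s i) 2 μ := by
  have : IsLinearMap ℝ fun s => f s i :=
    ⟨fun a b => by rw [hf.map_add]; rfl, fun c a => by rw [hf.map_smul]; rfl⟩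
  exact (hasGaussianLaw_of_isLinearMap this μ).memLp_two

lemma vecXW_isLinearMap : IsLinearMap ℝ (vecXW : State nx nw nz → _) where
  map_add a b := by ext (j | j) <;> rfl
  map_smul c a := by ext (j | j) <;> rfl

lemma vecZ_isLinearMap : IsLinearMap ℝ (vecZ : State nx nw nz → _) where
  map_add _ _ := rfl
  map_smul _ _ := rfl

lemma HasFiniteSecondMoment.memLp_eval (h : HasFiniteSecondMoment μ γ) (i : Fin ny) :
    MemLp (fun p : State nx nw nz × Vec ny => p.2 i) 2 (jointLaw μ γ) := by
  have hy : MemLp (fun p : State nx nw nz × Vec ny => p.2) 2 (jointLaw μ γ) := by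
    refine ⟨measurable_snd.aestronglyMeasurable, ?_⟩
    rw [eLpNorm_lt_top_iff_lintegral_rpow_enorm_lt_top two_ne_zero ENNReal.ofNat_ne_top]
    simpa [HasFiniteSecondMoment] using h
  refine hy.mono (by fun_prop) (Filter.Eventually.of_forall fun p => ?_)
  exact PiLp.norm_apply_le p.2 i

lemma HasFiniteSecondMoment.memLp_vecYZ [IsGaussian μ] (h : HasFiniteSecondMoment μ γ)
    (j : Fin ny ⊕ Fin nz) :
    MemLp (fun p : State nx nw nz × Vec ny => vecYZ p.2 p.1.2.2 j) 2 (jointLaw μ γ) := by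
  rcases j with j | j
  · exact h.memLp_eval j
  · exact memLp_jointLaw_of_memLp (memLp_eval_of_isLinearMap vecZ_isLinearMap j)

section Cost

variable {target : State nx nw nz → Vec n}

lemma estimationCost_eq [IsProbabilityMeasure μ] (ht : Measurable target)
    (η : Estimator ny nz n) :
    estimationCost μ target γ η = ∫⁻ p, ∫⁻ e, ‖target p.1 - e‖ₑ ^ 2
      ∂(η.kernel (p.2, p.1.2.2)) ∂(jointLaw μ γ) := by
  rw [jointLaw, Measure.lintegral_compProd]
  · rfl
  · have : Measurable fun q : (State nx nw nz × Vec ny) × Vec n => ‖target q.1.1 - q.2‖ₑ ^ 2 := by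
      fun_prop
    exact this.lintegral_kernel_prod_right'
      (κ := η.kernel.comap (fun p : State nx nw nz × Vec ny => (p.2, p.1.2.2)) (by fun_prop))

lemma estimationCost_of_usesGain [IsProbabilityMeasure μ] (ht : Measurable target)
    {η : Estimator ny nz n} {A : Matrix (Fin n) (Fin ny ⊕ Fin nz) ℝ} (h : UsesGain μ γ η A) :
    estimationCost μ target γ η =
      ∫⁻ p, ‖target p.1 - WithLp.toLp 2 (A.mulVec (vecYZ p.2 p.1.2.2))‖ₑ ^ 2 ∂(jointLaw μ γ) := by
  rw [estimationCost_eq ht]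
  refine lintegral_congr_ae ?_
  filter_upwards [h] with p hp
  rw [lintegral_congr_ae (g := fun _ =>
    ‖target p.1 - WithLp.toLp 2 (A.mulVec (vecYZ p.2 p.1.2.2))‖ₑ ^ 2)]
  · simp
  · filter_upwards [hp] with e he
    rw [he]

/-- The deterministic estimator with gain `A`. -/
noncomputable def linearEstimator (A : Matrix (Fin n) (Fin ny ⊕ Fin nz) ℝ) : Estimator ny nz n where
  kernel := Kernel.deterministic _ (measurable_gain A)
  isMarkov := inferInstance

lemma usesGain_linearEstimator (A : Matrix (Fin n) (Fin ny ⊕ Fin nz) ℝ) :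
    UsesGain μ γ (linearEstimator A) A := by
  refine Filter.Eventually.of_forall fun p => ?_
  simp only [linearEstimator, Kernel.deterministic_apply]
  exact (ae_dirac_iff (measurableSet_singleton _)).mpr rfl

/-- The gain of the linear least-mean-square estimator if the message has finite second moments,
and otherwise the gain of the optimal linear estimator that ignores the message. -/
noncomputable def lmsGain (μ : Measure (State nx nw nz)) (target : State nx nw nz → Vec n)
    (γ : Sender nx nw nz ny) : Matrix (Fin n) (Fin ny ⊕ Fin nz) ℝ :=
  open Classical in
  -- The second conjunct supplies a gain to choose; for Gaussian `μ` and a linear target it follows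
  -- from the first (`lmsGain_mul_obsMoment`).
  if h : HasFiniteSecondMoment μ γ ∧
      ∃ A : Matrix (Fin n) (Fin ny ⊕ Fin nz) ℝ, A * obsMoment μ γ = crossMoment μ target γ then
    h.2.choose
  else Matrix.fromCols 0 (secondMoment μ (fun s => target s) vecZ * (secondMoment μ vecZ vecZ)⁻¹)

lemma isLinearMap_coe_vec (ht : IsLinearMap ℝ target) :
    IsLinearMap ℝ fun s => (target s : Fin n → ℝ) :=
  ⟨fun a b => by rw [ht.map_add]; rfl, fun c a => by rw [ht.map_smul]; rfl⟩

lemma lmsGain_mul_obsMoment [IsGaussian μ] (ht : IsLinearMap ℝ target)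
    (h : HasFiniteSecondMoment μ γ) :
    lmsGain μ target γ * obsMoment μ γ = crossMoment μ target γ := by
  have hex : ∃ A : Matrix (Fin n) (Fin ny ⊕ Fin nz) ℝ,
      A * obsMoment μ γ = crossMoment μ target γ :=
    exists_mul_secondMoment_eq
      (fun i => memLp_jointLaw_of_memLp (memLp_eval_of_isLinearMap (isLinearMap_coe_vec ht) i))
      h.memLp_vecYZ
  rw [lmsGain, dif_pos ⟨h, hex⟩]
  exact hex.choose_spec

lemma lmsGain_of_not (h : ¬ HasFiniteSecondMoment μ γ) :
    lmsGain μ target γ = Matrix.fromCols 0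
      (secondMoment μ (fun s => target s) vecZ * (secondMoment μ vecZ vecZ)⁻¹) := by
  rw [lmsGain, dif_neg fun h' => h h'.1]

lemma eq_crossMoment_mul_inv {A : Matrix (Fin n) (Fin ny ⊕ Fin nz) ℝ}
    (hA : A * obsMoment μ γ = crossMoment μ target γ) (h : IsUnit (obsMoment μ γ).det) :
    A = crossMoment μ target γ * (obsMoment μ γ)⁻¹ := by
  rw [← hA, Matrix.mul_nonsing_inv_cancel_right _ _ h]

lemma isLinearLMS_lmsGain [IsGaussian μ] (ht : IsLinearMap ℝ target)
    (h : HasFiniteSecondMoment μ γ) :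
    IsLinearLMS μ target γ (linearEstimator (lmsGain μ target γ)) :=
  ⟨lmsGain μ target γ, lmsGain_mul_obsMoment ht h,
    eq_crossMoment_mul_inv (lmsGain_mul_obsMoment ht h), usesGain_linearEstimator _⟩

end Cost

end Estimators

/-! ### Optimality of linear estimation under a Gaussian law -/

section GaussianOptimality

/-- The cross term `2⟨c, X⟩` has mean zero, so a shift adds `‖c‖²`. Here `c` will be the gap between
the linear estimate and a competing one, fixed once the observation and the competitor's draw are
fixed. -/
lemma lintegral_enorm_sq_le_of_integral_eq_zero {Ω E : Type*} [MeasurableSpace Ω]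
    [NormedAddCommGroup E] [InnerProductSpace ℝ E] [CompleteSpace E] {P : Measure Ω}
    [IsProbabilityMeasure P] {X : Ω → E} (hX : MemLp X 2 P) (h0 : ∫ ω, X ω ∂P = 0) (c : E) :
    ∫⁻ ω, ‖X ω‖ₑ ^ 2 ∂P ≤ ∫⁻ ω, ‖X ω + c‖ₑ ^ 2 ∂P := by
  have e (v : E) : ‖v‖ₑ ^ 2 = ENNReal.ofReal (‖v‖ ^ 2) := by
    rw [← ofReal_norm, ENNReal.ofReal_pow (norm_nonneg _)]
  have hXi : Integrable X P := hX.integrable one_le_two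
  have h1 : Integrable (fun ω => ‖X ω‖ ^ 2) P := hX.norm.integrable_sq
  have h2 : Integrable (fun ω => ‖X ω + c‖ ^ 2) P :=
    (hX.add (memLp_const c)).norm.integrable_sq
  have h3 : Integrable (fun ω => 2 * inner ℝ c (X ω)) P := (hXi.const_inner c).const_mul 2
  simp only [e]
  rw [← ofReal_integral_eq_lintegral_ofReal h1 (Filter.Eventually.of_forall fun _ => sq_nonneg _),
    ← ofReal_integral_eq_lintegral_ofReal h2 (Filter.Eventually.of_forall fun _ => sq_nonneg _)]
  refine ENNReal.ofReal_le_ofReal ?_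
  have h4 : ∫ ω, ‖X ω + c‖ ^ 2 ∂P = ∫ ω, ‖X ω‖ ^ 2 ∂P + ‖c‖ ^ 2 := by
    have : ∀ ω, ‖X ω + c‖ ^ 2 = ‖X ω‖ ^ 2 + 2 * inner ℝ c (X ω) + ‖c‖ ^ 2 := fun ω => by
      rw [norm_add_sq_real, real_inner_comm]
    simp only [this]
    have h13 : Integrable (fun ω => ‖X ω‖ ^ 2 + 2 * inner ℝ c (X ω)) P := h1.add h3
    rw [integral_add h13 (integrable_const _), integral_add h1 h3, integral_const_mul,
      integral_inner hXi, h0]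
    simp
  rw [h4]
  exact le_add_of_nonneg_right (sq_nonneg _)

variable {nx nw nz ny n : ℕ} {μ : Measure (State nx nw nz)} {γ : Sender nx nw nz ny}
  {target : State nx nw nz → Vec n}

/-- Under a centred Gaussian joint law no randomized estimator beats the linear least-mean-square
estimator. -/
lemma lintegral_error_le_estimationCost [IsProbabilityMeasure μ] (hG : IsGaussian (jointLaw μ γ))
    (h0 : ∫ p, p ∂(jointLaw μ γ) = 0) (ht : IsLinearMap ℝ target)
    {A : Matrix (Fin n) (Fin ny ⊕ Fin nz) ℝ} (hA : A * obsMoment μ γ = crossMoment μ target γ)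
    (η : Estimator ny nz n) :
    ∫⁻ p, ‖target p.1 - WithLp.toLp 2 (A.mulVec (vecYZ p.2 p.1.2.2))‖ₑ ^ 2 ∂(jointLaw μ γ) ≤
      estimationCost μ target γ η := by
  set P := jointLaw μ γ
  have htm : Measurable target :=
    (LinearMap.continuous_of_finiteDimensional (ht.mk' target)).measurable
  let est : Vec ny × Vec nz → Vec n := fun o => WithLp.toLp 2 (A.mulVec (vecYZ o.1 o.2))
  let obs : State nx nw nz × Vec ny → Vec ny × Vec nz := fun p => (p.2, p.1.2.2)
  let err : State nx nw nz × Vec ny → Vec n := fun p => target p.1 - est (obs p)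
  have hest : Measurable est := measurable_gain A
  have hobs : Measurable obs := by fun_prop
  have hlvec : IsLinearMap ℝ fun p : State nx nw nz × Vec ny => vecYZ p.2 p.1.2.2 :=
    ⟨fun a b => vecYZ_isLinearMap.map_add (obs a) (obs b),
      fun c a => vecYZ_isLinearMap.map_smul c (obs a)⟩
  have hltgt : IsLinearMap ℝ fun p : State nx nw nz × Vec ny => (target p.1 : Fin n → ℝ) :=
    ⟨fun a b => (isLinearMap_coe_vec ht).map_add a.1 b.1,
      fun c a => (isLinearMap_coe_vec ht).map_smul c a.1⟩
  have hlerr : IsLinearMap ℝ fun p : State nx nw nz × Vec ny =>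
      (target p.1 : Fin n → ℝ) - A.mulVec (vecYZ p.2 p.1.2.2) :=
    ⟨fun a b => by rw [hltgt.map_add, hlvec.map_add, Matrix.mulVec_add]; abel,
      fun c a => by rw [hltgt.map_smul, hlvec.map_smul, Matrix.mulVec_smul, smul_sub]⟩
  have hlerr' : IsLinearMap ℝ err :=
    ⟨fun a b => congrArg (WithLp.toLp 2) (hlerr.map_add a b),
      fun c a => congrArg (WithLp.toLp 2) (hlerr.map_smul c a)⟩
  have hmem {ι : Type} [Fintype ι] {f : State nx nw nz × Vec ny → ι → ℝ} (hf : IsLinearMap ℝ f)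
      (i : ι) : MemLp (fun p => f p i) 2 P ∧ ∫ p, f p i ∂P = 0 := by
    have : IsLinearMap ℝ fun p => f p i :=
      ⟨fun a b => by rw [hf.map_add]; rfl, fun c a => by rw [hf.map_smul]; rfl⟩
    exact ⟨(hasGaussianLaw_of_isLinearMap this P).memLp_two,
      integral_eq_zero_of_isLinearMap this h0⟩
  -- Error and observation are jointly Gaussian, and uncorrelated by the normal equations, hence
  -- independent.
  have hindep : IndepFun err obs P := by
    have hpair : IsLinearMap ℝ fun p : State nx nw nz × Vec ny =>
        (((target p.1 : Fin n → ℝ) - A.mulVec (vecYZ p.2 p.1.2.2) : Fin n → ℝ),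
          vecYZ p.2 p.1.2.2) :=
      ⟨fun a b => Prod.ext (hlerr.map_add a b) (hlvec.map_add a b),
        fun c a => Prod.ext (hlerr.map_smul c a) (hlvec.map_smul c a)⟩
    have h := HasGaussianLaw.indepFun_of_covariance_eval
      (X := fun i (p : State nx nw nz × Vec ny) =>
        ((target p.1 : Fin n → ℝ) - A.mulVec (vecYZ p.2 p.1.2.2)) i)
      (Y := fun j (p : State nx nw nz × Vec ny) => vecYZ p.2 p.1.2.2 j)
      (hasGaussianLaw_of_isLinearMap hpair P)
      (fun i j => by
        rw [covariance_eq_sub (hmem hlerr i).1 (hmem hlvec j).1, (hmem hlerr i).2, zero_mul,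
          sub_zero]
        exact congrFun (congrFun (secondMoment_error_left (fun i => (hmem hltgt i).1)
          (fun j => (hmem hlvec j).1) hA) i) j)
    exact h.comp (φ := WithLp.toLp 2)
      (ψ := fun v => (WithLp.toLp 2 (fun j => v (.inl j)), WithLp.toLp 2 (fun j => v (.inr j))))
      (by fun_prop) (by fun_prop)
  have herr : Measurable err := by fun_prop
  have herr2 : MemLp err 2 P := (hasGaussianLaw_of_isLinearMap hlerr' P).memLp_two
  have herr0 : ∫ p, err p ∂P = 0 := integral_eq_zero_of_isLinearMap hlerr' h0
  rw [estimationCost_eq htm]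
  -- The competitor's error is the linear error plus `est - e`; `F` averages its square over the
  -- draw `e`.
  let F : Vec n × (Vec ny × Vec nz) → ℝ≥0∞ :=
    fun q => ∫⁻ e, ‖q.1 + (est q.2 - e)‖ₑ ^ 2 ∂(η.kernel q.2)
  have hF : Measurable F := by
    have : Measurable fun q : (Vec n × (Vec ny × Vec nz)) × Vec n =>
        ‖q.1.1 + (est q.1.2 - q.2)‖ₑ ^ 2 := by fun_prop
    exact this.lintegral_kernel_prod_right' (κ := η.kernel.comap Prod.snd measurable_snd)
  have hcost : ∫⁻ p, ∫⁻ e, ‖target p.1 - e‖ₑ ^ 2 ∂(η.kernel (p.2, p.1.2.2)) ∂P =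
      ∫⁻ q, F q ∂(P.map fun p => (err p, obs p)) := by
    rw [lintegral_map hF (herr.prodMk hobs)]
    refine lintegral_congr fun p => lintegral_congr fun e => ?_
    congr 2
    simp only [err]
    abel
  have : IsProbabilityMeasure (P.map err) := Measure.isProbabilityMeasure_map herr.aemeasurable
  have : IsProbabilityMeasure (P.map obs) := Measure.isProbabilityMeasure_map hobs.aemeasurable
  -- By independence the law of `(err, obs)` is a product, so the integral over the error can be
  -- taken innermost, with observation and draw fixed.
  rw [hcost, (indepFun_iff_map_prod_eq_prod_map_map herr.aemeasurable hobs.aemeasurable).mp hindep,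
    lintegral_prod_symm _ hF.aemeasurable]
  calc ∫⁻ p, ‖err p‖ₑ ^ 2 ∂P
      = ∫⁻ _ : Vec ny × Vec nz, (∫⁻ p, ‖err p‖ₑ ^ 2 ∂P) ∂(P.map obs) := by simp
    _ ≤ _ := lintegral_mono fun o => ?_
  simp only [F]
  rw [lintegral_lintegral_swap (by fun_prop)]
  calc ∫⁻ p, ‖err p‖ₑ ^ 2 ∂P
      = ∫⁻ _ : Vec n, (∫⁻ p, ‖err p‖ₑ ^ 2 ∂P) ∂(η.kernel o) := by simp
    _ ≤ _ := lintegral_mono fun e => ?_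
  rw [lintegral_map (by fun_prop) herr]
  exact lintegral_enorm_sq_le_of_integral_eq_zero herr2 herr0 _

end GaussianOptimality

/-! ### Error covariances of arbitrary policies -/

section Costs

open Matrix

variable {nx nw nz ny n : ℕ} {μ : Measure (State nx nw nz)} {γ : Sender nx nw nz ny}

lemma posDef_vecZ_and_schurCov (hcov : (secondMoment μ vecXWZ vecXWZ).PosDef) :
    (secondMoment μ vecZ vecZ).PosDef ∧ (schurCov μ).PosDef := by
  have h : secondMoment μ vecXWZ vecXWZ = fromBlocks (secondMoment μ vecXW vecXW)
      (secondMoment μ vecXW vecZ) (secondMoment μ vecXW vecZ)ᵀ (secondMoment μ vecZ vecZ) := by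
    rw [secondMoment_transpose]
    exact secondMoment_sumElim _ _ _ _
  rw [h] at hcov
  have h2 := posDef_schur hcov
  rwa [secondMoment_transpose] at h2

lemma isLinearMap_fst : IsLinearMap ℝ fun s : State nx nw nz => s.1 :=
  ⟨fun _ _ => rfl, fun _ _ => rfl⟩

lemma isLinearMap_snd_fst : IsLinearMap ℝ fun s : State nx nw nz => s.2.1 :=
  ⟨fun _ _ => rfl, fun _ _ => rfl⟩

lemma measurable_vecXW (i : Fin nx ⊕ Fin nw) :
    Measurable fun s : State nx nw nz => vecXW s i := by
  rcases i with i | i <;> simp only [vecXW, Sum.elim_inl, Sum.elim_inr] <;> fun_prop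

lemma measurable_vecZ (i : Fin nz) : Measurable fun s : State nx nw nz => vecZ s i := by
  simp only [vecZ]; fun_prop

lemma secondMoment_jointLaw_fst [IsProbabilityMeasure μ] {ι κ : Type*}
    {a : State nx nw nz → ι → ℝ} {b : State nx nw nz → κ → ℝ}
    (ha : ∀ i, Measurable fun s => a s i) (hb : ∀ j, Measurable fun s => b s j) :
    secondMoment (jointLaw μ γ) (fun p => a p.1) (fun p => b p.1) = secondMoment μ a b := by
  conv_rhs => rw [← map_fst_jointLaw (μ := μ) (γ := γ)]
  rw [secondMoment_map measurable_fst ha hb]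

/-- The error covariance of the estimation of `(x, w)` with the message `K (x, w) + v`. -/
noncomputable def errorCov (μ : Measure (State nx nw nz))
    (K : Matrix (Fin ny) (Fin nx ⊕ Fin nw) ℝ) : Matrix (Fin nx ⊕ Fin nw) (Fin nx ⊕ Fin nw) ℝ :=
  schurCov μ - schurCov μ * Kᵀ * K * schurCov μ

/-- The least-mean-square errors of the receiver and the malicious agent are the block traces of
the covariance `E`. -/
structure HasErrorCov (μ : Measure (State nx nw nz)) (γ : Sender nx nw nz ny)
    (E : Matrix (Fin nx ⊕ Fin nw) (Fin nx ⊕ Fin nw) ℝ) : Prop where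
  posSemidef : E.PosSemidef
  receiverCost_eq : receiverCost μ γ (linearEstimator (lmsGain μ (fun s => s.1) γ)) =
    ENNReal.ofReal E.toBlocks₁₁.trace
  maliciousCost_eq : maliciousCost μ γ (linearEstimator (lmsGain μ (fun s => s.2.1) γ)) =
    ENNReal.ofReal E.toBlocks₂₂.trace

/-- The gain of the linear least-mean-square estimator of `(x, w)`. -/
noncomputable def stackedGain (μ : Measure (State nx nw nz)) (γ : Sender nx nw nz ny) :
    Matrix (Fin nx ⊕ Fin nw) (Fin ny ⊕ Fin nz) ℝ :=
  fromRows (lmsGain μ (fun s => s.1) γ) (lmsGain μ (fun s => s.2.1) γ)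

/-- The covariance of the message given the side information. -/
noncomputable def messageCov (μ : Measure (State nx nw nz)) (γ : Sender nx nw nz ny) :
    Matrix (Fin ny) (Fin ny) ℝ :=
  secondMoment (jointLaw μ γ) (fun p => p.2) (fun p => p.2) -
    secondMoment (jointLaw μ γ) (fun p => p.2) (fun p => vecZ p.1) *
      (secondMoment μ vecZ vecZ)⁻¹ *
      (secondMoment (jointLaw μ γ) (fun p => p.2) (fun p => vecZ p.1))ᵀ

lemma memLp_vecXW [IsGaussian μ] (i : Fin nx ⊕ Fin nw) : MemLp (fun s => vecXW s i) 2 μ :=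
  memLp_eval_of_isLinearMap vecXW_isLinearMap i

lemma memLp_vecZ [IsGaussian μ] (i : Fin nz) : MemLp (fun s => vecZ s i) 2 μ :=
  memLp_eval_of_isLinearMap vecZ_isLinearMap i

lemma obsMoment_eq [IsProbabilityMeasure μ] : obsMoment μ γ =
    fromBlocks (secondMoment (jointLaw μ γ) (fun p => p.2) (fun p => p.2))
      (secondMoment (jointLaw μ γ) (fun p => p.2) (fun p => vecZ p.1))
      (secondMoment (jointLaw μ γ) (fun p => p.2) (fun p => vecZ p.1))ᵀ
      (secondMoment μ vecZ vecZ) := by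
  rw [secondMoment_transpose, ← secondMoment_jointLaw_fst (γ := γ) measurable_vecZ measurable_vecZ]
  exact secondMoment_sumElim _ _ _ _

lemma crossMoment_vecXW_eq [IsProbabilityMeasure μ] :
    secondMoment (jointLaw μ γ) (fun p => vecXW p.1) (fun p => vecYZ p.2 p.1.2.2) =
    fromCols (secondMoment (jointLaw μ γ) (fun p => vecXW p.1) (fun p => p.2))
      (secondMoment μ vecXW vecZ) := by
  rw [← secondMoment_jointLaw_fst (γ := γ) measurable_vecXW measurable_vecZ]
  exact secondMoment_sumElim_right _ _ _

lemma stackedGain_mul_obsMoment [IsGaussian μ] (h : HasFiniteSecondMoment μ γ) :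
    stackedGain μ γ * obsMoment μ γ =
      secondMoment (jointLaw μ γ) (fun p => vecXW p.1) (fun p => vecYZ p.2 p.1.2.2) := by
  rw [stackedGain, fromRows_mul, lmsGain_mul_obsMoment isLinearMap_fst h,
    lmsGain_mul_obsMoment isLinearMap_snd_fst h]
  exact (secondMoment_sumElim_left _ _ _).symm

lemma measurable_of_isLinearMap {target : State nx nw nz → Vec n} (ht : IsLinearMap ℝ target) :
    Measurable target :=
  (LinearMap.continuous_of_finiteDimensional (ht.mk' target)).measurable

/-- Both agents observe the same `(y, z)`, so their gains stack to one for `(x, w)` and their error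
covariances are the diagonal blocks of one matrix. As the second moment of an error it is
semidefinite, which later yields feasibility. -/
lemma HasFiniteSecondMoment.hasErrorCov [IsGaussian μ]
    (hZ : (secondMoment μ vecZ vecZ).PosDef) (h : HasFiniteSecondMoment μ γ) :
    HasErrorCov μ γ (schurCov μ - (stackedGain μ γ).toCols₁ * messageCov μ γ *
      (stackedGain μ γ).toCols₁ᵀ) := by
  have hs (i : Fin nx ⊕ Fin nw) : MemLp (fun p : State nx nw nz × Vec ny => vecXW p.1 i) 2
      (jointLaw μ γ) := memLp_jointLaw_of_memLp (memLp_vecXW i)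
  have hA := stackedGain_mul_obsMoment h
  have he := secondMoment_error hs h.memLp_vecYZ hA
  rw [← secondMoment_transpose (fun p : State nx nw nz × Vec ny => vecXW p.1)
      (fun p => vecYZ p.2 p.1.2.2), crossMoment_vecXW_eq,
    error_eq_schur_sub ((isUnit_iff_isUnit_det _).mp hZ.isUnit)
      (secondMoment_transpose _ _) (secondMoment_transpose _ _)
      (by rw [← obsMoment_eq, hA, crossMoment_vecXW_eq]),
    secondMoment_jointLaw_fst measurable_vecXW measurable_vecXW, secondMoment_transpose vecXW] at he
  change _ = schurCov μ - (stackedGain μ γ).toCols₁ * messageCov μ γ *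
    (stackedGain μ γ).toCols₁ᵀ at he
  have hmem (i : Fin nx ⊕ Fin nw) : MemLp (fun p : State nx nw nz × Vec ny =>
      (vecXW p.1 - (stackedGain μ γ).mulVec (vecYZ p.2 p.1.2.2)) i) 2 (jointLaw μ γ) :=
    (hs i).sub (memLp_mulVec _ h.memLp_vecYZ i)
  rw [← he]
  refine ⟨secondMoment_posSemidef hmem, ?_, ?_⟩
  · rw [receiverCost, estimationCost_of_usesGain (measurable_of_isLinearMap isLinearMap_fst)
      (usesGain_linearEstimator _), lintegral_enorm_sq_eq fun i => hmem (.inl i)]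
    rfl
  · rw [maliciousCost, estimationCost_of_usesGain (measurable_of_isLinearMap isLinearMap_snd_fst)
      (usesGain_linearEstimator _), lintegral_enorm_sq_eq fun i => hmem (.inr i)]
    rfl

lemma messageCov_posSemidef [IsGaussian μ] (hZ : (secondMoment μ vecZ vecZ).PosDef)
    (h : HasFiniteSecondMoment μ γ) : (messageCov μ γ).PosSemidef := by
  have := secondMoment_posSemidef h.memLp_vecYZ
  change (obsMoment μ γ).PosSemidef at this
  rw [obsMoment_eq, ← conjTranspose_eq_transpose_of_trivial] at this
  have : Invertible (secondMoment μ vecZ vecZ) := hZ.isUnit.invertible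
  exact (PosDef.fromBlocks₂₂ _ _ hZ).mp ‹_›

/-- The default gain ignores the message, so the errors are those of estimating from `z`. Both are
finite: such a deviation never has the indeterminate cost `⊤ - ⊤`, and it costs as much as `K = 0`.
-/
lemma hasErrorCov_of_not [IsGaussian μ] (hZ : (secondMoment μ vecZ vecZ).PosDef)
    (h : ¬ HasFiniteSecondMoment μ γ) : HasErrorCov μ γ (schurCov μ) := by
  set B := secondMoment μ vecXW vecZ * (secondMoment μ vecZ vecZ)⁻¹ with hB
  have he := secondMoment_error (P := μ) memLp_vecXW memLp_vecZ (A := B) (by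
    rw [hB, nonsing_inv_mul_cancel_right _ _ ((isUnit_iff_isUnit_det _).mp hZ.isUnit)])
  change _ = schurCov μ at he
  have hmem (i : Fin nx ⊕ Fin nw) : MemLp (fun s : State nx nw nz =>
      (vecXW s - B.mulVec (vecZ s)) i) 2 μ :=
    (memLp_vecXW i).sub (memLp_mulVec _ memLp_vecZ i)
  have cost {n : ℕ} {target : State nx nw nz → Vec n} (ht : IsLinearMap ℝ target) :
      estimationCost μ target γ (linearEstimator (lmsGain μ target γ)) =
        ∫⁻ s, ‖target s - WithLp.toLp 2 ((secondMoment μ (fun s => target s) vecZ *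
          (secondMoment μ vecZ vecZ)⁻¹).mulVec (vecZ s))‖ₑ ^ 2 ∂μ := by
    rw [estimationCost_of_usesGain (measurable_of_isLinearMap ht) (usesGain_linearEstimator _),
      lmsGain_of_not h]
    simp only [vecYZ, fromCols_mulVec_sumElim, zero_mulVec, zero_add]
    conv_rhs => rw [← map_fst_jointLaw (μ := μ) (γ := γ)]
    rw [lintegral_map ?_ measurable_fst, map_fst_jointLaw]
    · rfl
    · have h1 := measurable_of_isLinearMap ht
      have h2 : Measurable fun s : State nx nw nz => ((secondMoment μ (fun s => target s) vecZ *
          (secondMoment μ vecZ vecZ)⁻¹).mulVec (vecZ s)) :=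
        (LinearMap.continuous_of_finiteDimensional
          ((mulVecLin _).comp (vecZ_isLinearMap.mk' _))).measurable
      rw [map_fst_jointLaw]
      fun_prop
  rw [← he]
  refine ⟨secondMoment_posSemidef hmem, ?_, ?_⟩
  · rw [receiverCost, cost isLinearMap_fst, lintegral_enorm_sq_eq fun i => hmem (.inl i)]
    rfl
  · rw [maliciousCost, cost isLinearMap_snd_fst, lintegral_enorm_sq_eq fun i => hmem (.inr i)]
    rfl

lemma zero_mem_feasible : (0 : Matrix (Fin ny) (Fin nx ⊕ Fin nw) ℝ) ∈ feasible μ ny := by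
  simpa [feasible] using PosSemidef.one

/-- Reduces the sender's choice among all kernels to the quadratic program. -/
lemma exists_hasErrorCov [IsGaussian μ] (hcov : (secondMoment μ vecXWZ vecXWZ).PosDef)
    (γ : Sender nx nw nz ny) : ∃ K ∈ feasible μ ny, HasErrorCov μ γ (errorCov μ K) := by
  obtain ⟨hZ, hX⟩ := posDef_vecZ_and_schurCov hcov
  by_cases h : HasFiniteSecondMoment μ γ
  · have hE := h.hasErrorCov hZ
    obtain ⟨K, hK, hKE⟩ := exists_gain_of_reduction hX (messageCov_posSemidef hZ h) hE.posSemidef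
    exact ⟨K, hK, by rwa [errorCov, hKE]⟩
  · exact ⟨0, zero_mem_feasible, by simpa [errorCov] using hasErrorCov_of_not hZ h⟩

/-- Cyclicity of the trace puts `Ξ Kᵀ K Ξ` next to the weight, whose blocks pick out the two
diagonal blocks. -/
lemma objective_eq (δ : ℝ) (K : Matrix (Fin ny) (Fin nx ⊕ Fin nw) ℝ) :
    objective μ δ K = -(schurCov μ * Kᵀ * K * schurCov μ).toBlocks₁₁.trace +
      δ * (schurCov μ * Kᵀ * K * schurCov μ).toBlocks₂₂.trace := by
  have key (M : Matrix (Fin nx ⊕ Fin nw) (Fin nx ⊕ Fin nw) ℝ) :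
      (fromBlocks (-(1 : Matrix (Fin nx) (Fin nx) ℝ)) 0 0
        (δ • (1 : Matrix (Fin nw) (Fin nw) ℝ)) * M).trace =
        -M.toBlocks₁₁.trace + δ * M.toBlocks₂₂.trace := by
    conv_lhs => rw [← fromBlocks_toBlocks M]
    rw [fromBlocks_multiply]
    simp [trace, Finset.mul_sum]
  rw [← key, objective, Matrix.mul_assoc, Matrix.mul_assoc, trace_mul_comm (K * schurCov μ)]
  simp only [Matrix.mul_assoc]

lemma errorCov_trace_toBlocks₁₁ (K : Matrix (Fin ny) (Fin nx ⊕ Fin nw) ℝ) :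
    (errorCov μ K).toBlocks₁₁.trace = (schurCov μ).toBlocks₁₁.trace -
      (schurCov μ * Kᵀ * K * schurCov μ).toBlocks₁₁.trace := trace_sub _ _

lemma errorCov_trace_toBlocks₂₂ (K : Matrix (Fin ny) (Fin nx ⊕ Fin nw) ℝ) :
    (errorCov μ K).toBlocks₂₂.trace = (schurCov μ).toBlocks₂₂.trace -
      (schurCov μ * Kᵀ * K * schurCov μ).toBlocks₂₂.trace := trace_sub _ _

lemma trace_toBlocks₁₁_nonneg {E : Matrix (Fin nx ⊕ Fin nw) (Fin nx ⊕ Fin nw) ℝ}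
    (hE : E.PosSemidef) : 0 ≤ E.toBlocks₁₁.trace := (hE.submatrix Sum.inl).trace_nonneg

lemma trace_toBlocks₂₂_nonneg {E : Matrix (Fin nx ⊕ Fin nw) (Fin nx ⊕ Fin nw) ℝ}
    (hE : E.PosSemidef) : 0 ≤ E.toBlocks₂₂.trace := (hE.submatrix Sum.inr).trace_nonneg

/-- The terms without `K` are the cost of an uninformative message. -/
lemma HasErrorCov.senderCost_eq {δ : ℝ} {K : Matrix (Fin ny) (Fin nx ⊕ Fin nw) ℝ}
    (h : HasErrorCov μ γ (errorCov μ K)) :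
    senderCost μ δ γ (linearEstimator (lmsGain μ (fun s => s.1) γ))
      (linearEstimator (lmsGain μ (fun s => s.2.1) γ)) =
    (((schurCov μ).toBlocks₁₁.trace - δ * (schurCov μ).toBlocks₂₂.trace + objective μ δ K : ℝ) :
      EReal) := by
  rw [senderCost, h.receiverCost_eq, h.maliciousCost_eq, EReal.coe_ennreal_ofReal,
    EReal.coe_ennreal_ofReal, max_eq_left (trace_toBlocks₁₁_nonneg h.posSemidef),
    max_eq_left (trace_toBlocks₂₂_nonneg h.posSemidef), ← EReal.coe_mul, ← EReal.coe_sub,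
    EReal.coe_eq_coe_iff, errorCov_trace_toBlocks₁₁, errorCov_trace_toBlocks₂₂, objective_eq]
  ring

end Costs

/-! ### The Gaussian policies -/

section GaussianSender

open Matrix

variable {nx nw nz ny n : ℕ} {μ : Measure (State nx nw nz)}
  {K : Matrix (Fin ny) (Fin nx ⊕ Fin nw) ℝ}

/-- The law of the noise in the policy `gaussianSender μ K`. -/
noncomputable abbrev noiseLaw (μ : Measure (State nx nw nz))
    (K : Matrix (Fin ny) (Fin nx ⊕ Fin nw) ℝ) : Measure (Vec ny) :=
  multivariateGaussian 0 (1 - K * schurCov μ * Kᵀ)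

/-- The state and the message as a function of the state and the noise. -/
noncomputable def stateMessage (K : Matrix (Fin ny) (Fin nx ⊕ Fin nw) ℝ)
    (p : State nx nw nz × Vec ny) : State nx nw nz × Vec ny :=
  (p.1, K.toCols₁.toEuclideanLin p.1.1 + K.toCols₂.toEuclideanLin p.1.2.1 + p.2)

lemma isLinearMap_stateMessage :
    IsLinearMap ℝ (stateMessage K : State nx nw nz × Vec ny → _) where
  map_add a b := by
    refine Prod.ext rfl ?_
    simp only [stateMessage, Prod.fst_add, Prod.snd_add, map_add]
    abel
  map_smul c a := by
    refine Prod.ext rfl ?_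
    simp only [stateMessage, Prod.smul_fst, Prod.smul_snd, map_smul, smul_add]

lemma measurable_stateMessage :
    Measurable (stateMessage K : State nx nw nz × Vec ny → _) := by
  have h₁ : Continuous K.toCols₁.toEuclideanLin := LinearMap.continuous_of_finiteDimensional _
  have h₂ : Continuous K.toCols₂.toEuclideanLin := LinearMap.continuous_of_finiteDimensional _
  unfold stateMessage
  fun_prop

/-- As a linear image of a product measure, the joint law inherits Gaussianity and mean zero when
`μ` has them, and its moments can be computed. -/
lemma jointLaw_gaussianSender [IsProbabilityMeasure μ] :
    jointLaw μ (gaussianSender μ K) = (μ.prod (noiseLaw μ K)).map (stateMessage K) := by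
  have hm : Measurable fun p : State nx nw nz × Vec ny =>
      K.toCols₁.toEuclideanLin p.1.1 + K.toCols₂.toEuclideanLin p.1.2.1 + p.2 :=
    measurable_snd.comp measurable_stateMessage
  refine Measure.ext_of_lintegral _ fun f hf => ?_
  have hfm : Measurable fun p => f (stateMessage K p) := hf.comp measurable_stateMessage
  rw [jointLaw, Measure.lintegral_compProd hf, lintegral_map hf measurable_stateMessage,
    lintegral_prod _ hfm.aemeasurable]
  refine lintegral_congr fun s => ?_
  have hfs : Measurable fun y => f (s, y) := by fun_prop
  simp only [gaussianSender]
  rw [Kernel.lintegral_map _ hm _ hfs]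
  exact Kernel.lintegral_id_prod (hfs.comp hm) _ s

lemma isGaussian_jointLaw_gaussianSender [IsGaussian μ] :
    IsGaussian (jointLaw μ (gaussianSender μ K)) := by
  rw [jointLaw_gaussianSender]
  exact (hasGaussianLaw_of_isLinearMap isLinearMap_stateMessage _).isGaussian_map

lemma integral_prod_noiseLaw [IsGaussian μ] (hmean : ∫ s, s ∂μ = 0) :
    ∫ p, p ∂(μ.prod (noiseLaw μ K)) = 0 := by
  have h := integral_pair (μ := μ.prod (noiseLaw μ K)) (f := fun p => p.1) (g := fun p => p.2)
    (IsGaussian.integrable_id.fst) (IsGaussian.integrable_id.snd)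
  refine h.trans (Prod.ext ?_ ?_)
  · exact (integral_fun_fst fun s => s).trans (by simp [hmean])
  · exact (integral_fun_snd fun v => v).trans (by simp)

lemma integral_jointLaw_gaussianSender [IsGaussian μ] (hmean : ∫ s, s ∂μ = 0) :
    ∫ p, p ∂(jointLaw μ (gaussianSender μ K)) = 0 := by
  rw [jointLaw_gaussianSender, integral_map measurable_stateMessage.aemeasurable
    (f := fun p => p) aestronglyMeasurable_id]
  exact integral_eq_zero_of_isLinearMap isLinearMap_stateMessage (integral_prod_noiseLaw hmean)

lemma hasFiniteSecondMoment_of_isGaussian {γ : Sender nx nw nz ny}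
    (h : IsGaussian (jointLaw μ γ)) : HasFiniteSecondMoment μ γ := by
  have : MemLp (fun p : State nx nw nz × Vec ny => p.2) 2 (jointLaw μ γ) :=
    (hasGaussianLaw_of_isLinearMap (f := fun p : State nx nw nz × Vec ny => p.2)
      ⟨fun _ _ => rfl, fun _ _ => rfl⟩ _).memLp_two
  simpa [HasFiniteSecondMoment] using
    (eLpNorm_lt_top_iff_lintegral_rpow_enorm_lt_top two_ne_zero ENNReal.ofNat_ne_top).mp this.2

lemma stateMessage_snd (p : State nx nw nz × Vec ny) :
    ((stateMessage K p).2 : Fin ny → ℝ) = K *ᵥ vecXW p.1 + p.2 := by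
  conv_rhs => rw [← fromCols_toCols K]
  simp only [vecXW, fromCols_mulVec_sumElim]
  rfl

section Moments

variable [IsGaussian μ]

lemma secondMoment_prod_fst {ι κ : Type*} {a : State nx nw nz → ι → ℝ}
    {b : State nx nw nz → κ → ℝ} :
    secondMoment (μ.prod (noiseLaw μ K)) (fun p => a p.1) (fun p => b p.1) =
      secondMoment μ a b := by
  ext i j
  exact (integral_fun_fst (μ := μ) (ν := noiseLaw μ K) fun s => a s i * b s j).trans (by
    simp [secondMoment])

lemma secondMoment_prod_fst_snd {ι : Type*} {a : State nx nw nz → ι → ℝ} :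
    secondMoment (μ.prod (noiseLaw μ K)) (fun p => a p.1) (fun p => p.2) = 0 := by
  ext i j
  have h0 : ∫ v, v j ∂(noiseLaw μ K) = 0 :=
    integral_eq_zero_of_isLinearMap (f := fun v : Vec ny => v j)
      ⟨fun _ _ => rfl, fun _ _ => rfl⟩ (by simp)
  exact (integral_prod_mul (fun s => a s i) (fun v : Vec ny => v j)).trans
    (by rw [h0, mul_zero]; rfl)

lemma secondMoment_prod_snd (hK : K ∈ feasible μ ny) :
    secondMoment (μ.prod (noiseLaw μ K)) (fun p => p.2) (fun p => p.2) =
      1 - K * schurCov μ * Kᵀ := by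
  ext i j
  have h0 (j : Fin ny) : ∫ v, v j ∂(noiseLaw μ K) = 0 :=
    integral_eq_zero_of_isLinearMap (f := fun v : Vec ny => v j)
      ⟨fun _ _ => rfl, fun _ _ => rfl⟩ (by simp)
  have h2 (j : Fin ny) : MemLp (fun v : Vec ny => v j) 2 (noiseLaw μ K) :=
    (hasGaussianLaw_of_isLinearMap (f := fun v : Vec ny => v j)
      ⟨fun _ _ => rfl, fun _ _ => rfl⟩ _).memLp_two
  -- Feasibility `hK` says that the prescribed noise covariance is semidefinite.
  have hc := covariance_eval_multivariateGaussian (μ := (0 : Vec ny)) hK i j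
  rw [covariance_eq_sub (h2 i) (h2 j), h0 i, zero_mul, sub_zero] at hc
  rw [← hc]
  exact (integral_fun_snd (μ := μ) (ν := noiseLaw μ K) fun v => v i * v j).trans (by simp)

lemma memLp_prod_snd (j : Fin ny) :
    MemLp (fun p => p.2 j) 2 (μ.prod (noiseLaw μ K)) :=
  (hasGaussianLaw_of_isLinearMap (f := fun p : State nx nw nz × Vec ny => p.2 j)
    ⟨fun _ _ => rfl, fun _ _ => rfl⟩ _).memLp_two

lemma secondMoment_gaussianSender_cross {ι : Type*} {a : State nx nw nz → ι → ℝ}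
    (ha : ∀ i, Measurable fun s => a s i) (ha' : ∀ i, MemLp (fun s => a s i) 2 μ) :
    secondMoment (jointLaw μ (gaussianSender μ K)) (fun p => a p.1) (fun p => p.2) =
      secondMoment μ a vecXW * Kᵀ := by
  rw [jointLaw_gaussianSender, secondMoment_map (a := fun p => a p.1) measurable_stateMessage
    (fun i => (ha i).comp measurable_fst) (fun j => by fun_prop)]
  simp only [stateMessage_snd]
  change secondMoment _ (fun p : State nx nw nz × Vec ny => a p.1) _ = _
  rw [secondMoment_add_right (fun i => (ha' i).comp_fst _)
    (memLp_mulVec K fun i => (memLp_vecXW i).comp_fst _) memLp_prod_snd,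
    secondMoment_mulVec_right K (fun i => (ha' i).comp_fst _)
      (fun i => (memLp_vecXW i).comp_fst _), secondMoment_prod_fst, secondMoment_prod_fst_snd,
    add_zero]

lemma secondMoment_gaussianSender_message (hK : K ∈ feasible μ ny) :
    secondMoment (jointLaw μ (gaussianSender μ K)) (fun p => p.2) (fun p => p.2) =
      K * secondMoment μ vecXW vecXW * Kᵀ + (1 - K * schurCov μ * Kᵀ) := by
  have hs (i : Fin nx ⊕ Fin nw) : MemLp (fun p : State nx nw nz × Vec ny => vecXW p.1 i) 2
      (μ.prod (noiseLaw μ K)) := (memLp_vecXW i).comp_fst _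
  have hKs := memLp_mulVec K hs
  rw [jointLaw_gaussianSender, secondMoment_map measurable_stateMessage
    (fun i => by fun_prop) (fun j => by fun_prop)]
  simp only [stateMessage_snd]
  have hy (j : Fin ny) : MemLp (fun p : State nx nw nz × Vec ny =>
      (K *ᵥ vecXW p.1 + (p.2 : Fin ny → ℝ)) j) 2 (μ.prod (noiseLaw μ K)) :=
    (hKs j).add (memLp_prod_snd j)
  rw [secondMoment_add_left hKs memLp_prod_snd hy,
    secondMoment_add_right hKs hKs memLp_prod_snd,
    secondMoment_add_right memLp_prod_snd hKs memLp_prod_snd,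
    secondMoment_mulVec_left K hs hKs, secondMoment_mulVec_right K hs hs,
    secondMoment_mulVec_left K hs memLp_prod_snd, secondMoment_mulVec_right K memLp_prod_snd hs,
    secondMoment_prod_snd hK, secondMoment_prod_fst, secondMoment_prod_fst_snd,
    ← secondMoment_transpose (fun p : State nx nw nz × Vec ny => vecXW p.1),
    secondMoment_prod_fst_snd]
  simp [Matrix.mul_assoc]

/-- Given `z`, the part `K (x, w)` has covariance `K Ξ Kᵀ`; the noise covariance is chosen to
complete it to the identity. -/
lemma messageCov_gaussianSender (hK : K ∈ feasible μ ny) :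
    messageCov μ (gaussianSender μ K) = 1 := by
  have h : secondMoment (jointLaw μ (gaussianSender μ K)) (fun p => p.2) (fun p => vecZ p.1) =
      K * secondMoment μ vecXW vecZ := by
    rw [← secondMoment_transpose, secondMoment_gaussianSender_cross measurable_vecZ memLp_vecZ,
      transpose_mul, transpose_transpose, secondMoment_transpose]
  rw [messageCov, h, secondMoment_gaussianSender_message hK, schurCov, transpose_mul,
    secondMoment_transpose]
  simp only [Matrix.mul_sub, Matrix.sub_mul, Matrix.mul_assoc]
  abel

/-- Since the message has identity covariance given `z`, eliminating `z` from the normal equations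
gives the gain `Ξ Kᵀ` on `y`, and the reduction is `Ξ Kᵀ K Ξ`. -/
lemma hasErrorCov_gaussianSender (hZ : (secondMoment μ vecZ vecZ).PosDef)
    (hK : K ∈ feasible μ ny) : HasErrorCov μ (gaussianSender μ K) (errorCov μ K) := by
  have hfin := hasFiniteSecondMoment_of_isGaussian
    (isGaussian_jointLaw_gaussianSender (μ := μ) (K := K))
  have hE := hfin.hasErrorCov hZ
  have hG := stackedGain_mul_obsMoment hfin
  rw [obsMoment_eq, crossMoment_vecXW_eq] at hG
  have hG' := toCols₁_mul_schur ((isUnit_iff_isUnit_det _).mp hZ.isUnit) hG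
  change (stackedGain μ (gaussianSender μ K)).toCols₁ * messageCov μ (gaussianSender μ K) = _ at hG'
  rw [secondMoment_transpose, secondMoment_gaussianSender_cross measurable_vecXW memLp_vecXW,
    secondMoment_gaussianSender_cross measurable_vecZ memLp_vecZ] at hG'
  have hG'' : (stackedGain μ (gaussianSender μ K)).toCols₁ = schurCov μ * Kᵀ := by
    rw [messageCov_gaussianSender hK, Matrix.mul_one] at hG'
    rw [hG', schurCov, Matrix.sub_mul, Matrix.mul_assoc _ _ Kᵀ]
  have hX : (schurCov μ)ᵀ = schurCov μ := by
    simp only [schurCov, transpose_sub, transpose_mul, transpose_nonsing_inv,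
      secondMoment_transpose, Matrix.mul_assoc]
  rw [messageCov_gaussianSender hK, hG'', Matrix.mul_one, transpose_mul, transpose_transpose, hX,
    ← Matrix.mul_assoc] at hE
  exact hE

/-- The determinant is `det V_zz` times that of the message covariance given `z`, which is 1. -/
lemma isUnit_det_obsMoment_gaussianSender (hZ : (secondMoment μ vecZ vecZ).PosDef)
    (hK : K ∈ feasible μ ny) : IsUnit (obsMoment μ (gaussianSender μ K)).det := by
  have : Invertible (secondMoment μ vecZ vecZ) := hZ.isUnit.invertible
  rw [obsMoment_eq, det_fromBlocks₂₂, invOf_eq_nonsing_inv]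
  change IsUnit (_ * (messageCov μ (gaussianSender μ K)).det)
  rw [messageCov_gaussianSender hK, det_one, mul_one]
  exact (isUnit_iff_isUnit_det _).mp hZ.isUnit

end Moments

end GaussianSender

/-! ### Equilibrium, rescaled messages and informativeness -/

section Equilibrium

open Matrix

variable {nx nw nz ny n : ℕ} {μ : Measure (State nx nw nz)} {γ : Sender nx nw nz ny}
  {target : State nx nw nz → Vec n} {K : Matrix (Fin ny) (Fin nx ⊕ Fin nw) ℝ} {δ : ℝ}

lemma estimationCost_lmsGain_le [IsGaussian μ] (hG : IsGaussian (jointLaw μ γ))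
    (h0 : ∫ p, p ∂(jointLaw μ γ) = 0) (ht : IsLinearMap ℝ target) (η : Estimator ny nz n) :
    estimationCost μ target γ (linearEstimator (lmsGain μ target γ)) ≤
      estimationCost μ target γ η := by
  rw [estimationCost_of_usesGain (measurable_of_isLinearMap ht) (usesGain_linearEstimator _)]
  exact lintegral_error_le_estimationCost hG h0 ht
    (lmsGain_mul_obsMoment ht (hasFiniteSecondMoment_of_isGaussian hG)) η

lemma gaussianSender_mem_withoutSideInformation :
    gaussianSender μ K ∈ withoutSideInformation nx nw nz ny := by
  have h₁ : Continuous K.toCols₁.toEuclideanLin := LinearMap.continuous_of_finiteDimensional _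
  have h₂ : Continuous K.toCols₂.toEuclideanLin := LinearMap.continuous_of_finiteDimensional _
  have hm : Measurable fun p : (Vec nx × Vec nw) × Vec ny =>
      K.toCols₁.toEuclideanLin p.1.1 + K.toCols₂.toEuclideanLin p.1.2 + p.2 := by fun_prop
  have hm' : Measurable fun p : State nx nw nz × Vec ny =>
      K.toCols₁.toEuclideanLin p.1.1 + K.toCols₂.toEuclideanLin p.1.2.1 + p.2 := by fun_prop
  refine ⟨⟨(Kernel.id ×ₖ Kernel.const _ (noiseLaw μ K)).map _,
    Kernel.IsMarkovKernel.map _ hm⟩, fun x w z => ?_⟩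
  simp only [gaussianSender]
  rw [Kernel.map_apply _ hm, Kernel.map_apply _ hm', Kernel.prod_apply, Kernel.prod_apply,
    Kernel.id_apply, Kernel.id_apply, Kernel.const_apply, Kernel.const_apply, Measure.dirac_prod,
    Measure.dirac_prod, Measure.map_map hm measurable_prodMk_left,
    Measure.map_map hm' measurable_prodMk_left]
  rfl

lemma measurable_toEuclideanLin (κ : Matrix (Fin ny) (Fin ny) ℝ) :
    Measurable κ.toEuclideanLin :=
  (LinearMap.continuous_of_finiteDimensional _).measurable

lemma scale_mem_withoutSideInformation (h : γ ∈ withoutSideInformation nx nw nz ny)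
    (κ : Matrix (Fin ny) (Fin ny) ℝ) : γ.scale κ ∈ withoutSideInformation nx nw nz ny := by
  obtain ⟨γ₀, h₀⟩ := h
  refine ⟨γ₀.scale κ, fun x w z => ?_⟩
  simp only [Policy.scale]
  rw [Kernel.map_apply _ (measurable_toEuclideanLin κ),
    Kernel.map_apply _ (measurable_toEuclideanLin κ), h₀]

/-- The estimator `η` applied to `κ y` in place of `y`. -/
noncomputable def precompMessage (κ : Matrix (Fin ny) (Fin ny) ℝ) (η : Estimator ny nz n) :
    Estimator ny nz n where
  kernel := η.kernel.comap (fun o => (κ.toEuclideanLin o.1, o.2))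
    (((measurable_toEuclideanLin κ).comp measurable_fst).prodMk measurable_snd)
  isMarkov := inferInstance

lemma precompMessage_inv {κ : Matrix (Fin ny) (Fin ny) ℝ} (hκ : κ.det ≠ 0)
    (η : Estimator ny nz n) : precompMessage κ (precompMessage κ⁻¹ η) = η := by
  have h (y : Vec ny) : κ⁻¹.toEuclideanLin (κ.toEuclideanLin y) = y := by
    simp only [toLpLin_apply, mulVec_mulVec, nonsing_inv_mul _ hκ.isUnit, one_mulVec]
  cases η
  simp only [precompMessage, Policy.mk.injEq]
  ext o : 1
  simp only [Kernel.comap_apply, h]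

lemma estimationCost_scale (κ : Matrix (Fin ny) (Fin ny) ℝ) (η : Estimator ny nz n) :
    estimationCost μ target (γ.scale κ) η = estimationCost μ target γ (precompMessage κ η) := by
  refine lintegral_congr fun s => ?_
  simp only [Policy.scale]
  rw [Kernel.lintegral_map _ (measurable_toEuclideanLin κ)]
  · rfl
  · have : Measurable fun q : Vec ny × Vec n => ‖target s - q.2‖ₑ ^ 2 := by fun_prop
    exact this.lintegral_kernel_prod_right'
      (κ := η.kernel.comap (fun y : Vec ny => (y, s.2.2)) (by fun_prop))

lemma jointLaw_scale [IsProbabilityMeasure μ] (κ : Matrix (Fin ny) (Fin ny) ℝ) :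
    jointLaw μ (γ.scale κ) = (jointLaw μ γ).map fun p => (p.1, κ.toEuclideanLin p.2) := by
  have hκ := measurable_toEuclideanLin κ
  have hm : Measurable fun p : State nx nw nz × Vec ny => (p.1, κ.toEuclideanLin p.2) := by fun_prop
  refine Measure.ext_of_lintegral _ fun f hf => ?_
  have hfm : Measurable fun p : State nx nw nz × Vec ny => f (p.1, κ.toEuclideanLin p.2) :=
    hf.comp hm
  rw [lintegral_map hf hm, jointLaw, jointLaw, Measure.lintegral_compProd hf,
    Measure.lintegral_compProd hfm]
  refine lintegral_congr fun s => ?_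
  simp only [Policy.scale]
  rw [Kernel.lintegral_map _ hκ _ (by fun_prop)]

lemma isLinearMap_scale (κ : Matrix (Fin ny) (Fin ny) ℝ) :
    IsLinearMap ℝ fun p : State nx nw nz × Vec ny => (p.1, κ.toEuclideanLin p.2) :=
  ⟨fun _ _ => Prod.ext rfl (map_add _ _ _), fun _ _ => Prod.ext rfl (map_smul _ _ _)⟩

lemma isGaussian_jointLaw_scale [IsProbabilityMeasure μ] (hG : IsGaussian (jointLaw μ γ))
    (κ : Matrix (Fin ny) (Fin ny) ℝ) : IsGaussian (jointLaw μ (γ.scale κ)) := by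
  rw [jointLaw_scale]
  exact (hasGaussianLaw_of_isLinearMap (isLinearMap_scale κ) _).isGaussian_map

lemma integral_jointLaw_scale [IsProbabilityMeasure μ] (hG : IsGaussian (jointLaw μ γ))
    (h0 : ∫ p, p ∂(jointLaw μ γ) = 0) (κ : Matrix (Fin ny) (Fin ny) ℝ) :
    ∫ p, p ∂(jointLaw μ (γ.scale κ)) = 0 := by
  have hκ := measurable_toEuclideanLin κ
  have hm : Measurable fun p : State nx nw nz × Vec ny => (p.1, κ.toEuclideanLin p.2) := by fun_prop
  rw [jointLaw_scale, integral_map hm.aemeasurable (f := fun p => p) aestronglyMeasurable_id]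
  exact integral_eq_zero_of_isLinearMap (isLinearMap_scale κ) h0

/-- An invertible linear transformation of the message does not change the errors. -/
lemma estimationCost_lmsGain_scale [IsGaussian μ] (hG : IsGaussian (jointLaw μ γ))
    (h0 : ∫ p, p ∂(jointLaw μ γ) = 0) (ht : IsLinearMap ℝ target)
    {κ : Matrix (Fin ny) (Fin ny) ℝ} (hκ : κ.det ≠ 0) :
    estimationCost μ target (γ.scale κ) (linearEstimator (lmsGain μ target (γ.scale κ))) =
      estimationCost μ target γ (linearEstimator (lmsGain μ target γ)) := by
  -- Both joint laws are centred Gaussian, so each linear estimator does at least as well as the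
  -- other one transported by `κ⁻¹` or `κ`.
  apply le_antisymm
  · refine (estimationCost_lmsGain_le (isGaussian_jointLaw_scale hG κ)
      (integral_jointLaw_scale hG h0 κ) ht
      (precompMessage κ⁻¹ (linearEstimator (lmsGain μ target γ)))).trans_eq ?_
    rw [estimationCost_scale, precompMessage_inv hκ]
  · rw [estimationCost_scale]
    exact estimationCost_lmsGain_le hG h0 ht _

lemma HasErrorCov.scale [IsGaussian μ] {E : Matrix (Fin nx ⊕ Fin nw) (Fin nx ⊕ Fin nw) ℝ}
    (h : HasErrorCov μ γ E) (hG : IsGaussian (jointLaw μ γ))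
    (h0 : ∫ p, p ∂(jointLaw μ γ) = 0) {κ : Matrix (Fin ny) (Fin ny) ℝ} (hκ : κ.det ≠ 0) :
    HasErrorCov μ (γ.scale κ) E :=
  ⟨h.posSemidef, (estimationCost_lmsGain_scale hG h0 isLinearMap_fst hκ).trans h.receiverCost_eq,
    (estimationCost_lmsGain_scale hG h0 isLinearMap_snd_fst hκ).trans h.maliciousCost_eq⟩

/-- Asks of `γ` only a centred Gaussian joint law and the error covariance of a minimizer, so that
it covers the rescaled policies too. -/
lemma isEquilibrium_of_hasErrorCov [IsGaussian μ] (hcov : (secondMoment μ vecXWZ vecXWZ).PosDef)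
    {Γ : Set (Sender nx nw nz ny)} (hγ : γ ∈ Γ) (hG : IsGaussian (jointLaw μ γ))
    (h0 : ∫ p, p ∂(jointLaw μ γ) = 0) (hK : K ∈ minimizers μ δ ny)
    (hE : HasErrorCov μ γ (errorCov μ K)) :
    IsEquilibrium μ δ Γ (fun γ => linearEstimator (lmsGain μ (fun s => s.1) γ))
      (fun γ => linearEstimator (lmsGain μ (fun s => s.2.1) γ)) γ where
  mem := hγ
  receiverCost_ne_top := by rw [hE.receiverCost_eq]; exact ENNReal.ofReal_ne_top
  maliciousCost_ne_top := by rw [hE.maliciousCost_eq]; exact ENNReal.ofReal_ne_top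
  receiver_optimal _ := estimationCost_lmsGain_le hG h0 isLinearMap_fst _
  malicious_optimal _ := estimationCost_lmsGain_le hG h0 isLinearMap_snd_fst _
  sender_optimal γ' _ := by
    obtain ⟨K', hK', hE'⟩ := exists_hasErrorCov hcov γ'
    rw [hE.senderCost_eq, hE'.senderCost_eq, EReal.coe_le_coe_iff]
    linarith [hK.2 K' hK']

lemma minimizers_nonempty (hX : (schurCov μ).PosDef) (δ : ℝ) (ny : ℕ) :
    (minimizers μ δ ny).Nonempty := by
  obtain ⟨K, hK, hmin⟩ := exists_forall_trace_le (p := Fin ny) hX (schurCov μ *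
    fromBlocks (-(1 : Matrix (Fin nx) (Fin nx) ℝ)) 0 0 (δ • (1 : Matrix (Fin nw) (Fin nw) ℝ)) *
    schurCov μ)
  refine ⟨K, hK, fun K' hK' => ?_⟩
  simpa only [objective, Matrix.mul_assoc] using hmin K' hK'

/-- The gain with `K Ξ = t e_j e_iᵀ`, for an `x`-coordinate `i`, has the reduction `t² e_i e_iᵀ`. It
lies in the `x` block, so the objective is `-t²` for every `δ`. -/
lemma exists_objective_neg (hX : (schurCov μ).PosDef) (δ : ℝ) (hnx : 0 < nx) (hny : 0 < ny) :
    ∃ K ∈ feasible μ ny, objective μ δ K < 0 := by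
  let i : Fin nx ⊕ Fin nw := .inl ⟨0, hnx⟩
  let j : Fin ny := ⟨0, hny⟩
  have hu : IsUnit (schurCov μ).det := (isUnit_iff_isUnit_det _).mp hX.isUnit
  have ha : 0 < (schurCov μ)⁻¹ i i := hX.inv.diag_pos
  set a := (schurCov μ)⁻¹ i i with haa
  have hXt : (schurCov μ)ᵀ = schurCov μ := by simpa using hX.isHermitian.eq
  -- Feasibility amounts to `a t² ≤ 1`; this `t` satisfies both `t ≤ 1` and `a t ≤ 1`.
  let t : ℝ := (1 + a)⁻¹
  have ht : 0 < t := by positivity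
  have hta : t * (a * t) ≤ 1 := by
    have : t * (1 + a) = 1 := inv_mul_cancel₀ (by positivity)
    nlinarith [mul_pos ht ha]
  refine ⟨single j i t * (schurCov μ)⁻¹, ?_, ?_⟩
  · have e : single j i t * (schurCov μ)⁻¹ * schurCov μ * (single j i t * (schurCov μ)⁻¹)ᵀ =
        diagonal (Pi.single j (t * (a * t))) := by
      rw [nonsing_inv_mul_cancel_right _ _ hu, transpose_mul, transpose_nonsing_inv, hXt,
        transpose_single, diagonal_single, ← Matrix.mul_assoc, single_mul_mul_single, ← haa]
      congr 1
      ring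
    change (1 - _ : Matrix (Fin ny) (Fin ny) ℝ).PosSemidef
    rw [e, ← diagonal_one, diagonal_sub]
    refine PosSemidef.diagonal fun k => ?_
    by_cases hk : k = j
    · subst hk; simpa using hta
    · simp [hk]
  · have e : schurCov μ * (single j i t * (schurCov μ)⁻¹)ᵀ * (single j i t * (schurCov μ)⁻¹) *
        schurCov μ = single i i (t * t) := by
      rw [Matrix.mul_assoc, nonsing_inv_mul_cancel_right _ _ hu, transpose_mul,
        transpose_nonsing_inv, hXt, mul_nonsing_inv_cancel_left _ _ hu, transpose_single,
        single_mul_single_same]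
    rw [objective_eq, e]
    have h₁ : (single i i (t * t)).toBlocks₁₁.trace = t * t := by
      simp [trace, toBlocks₁₁, i, single_apply]
    have h₂ : (single i i (t * t)).toBlocks₂₂.trace = 0 := by
      simp [trace, toBlocks₂₂, i]
    rw [h₁, h₂]
    nlinarith

/-- A negative minimum together with `δ ≥ 0` forces a positive trace of the `x` block of the
reduction. -/
lemma isInformative_of_minimizer [IsGaussian μ] (hmean : ∫ s, s ∂μ = 0)
    (hcov : (secondMoment μ vecXWZ vecXWZ).PosDef) (hδ : 0 ≤ δ) (hnx : 0 < nx) (hny : 0 < ny)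
    (hK : K ∈ minimizers μ δ ny) :
    IsInformative μ (fun γ => linearEstimator (lmsGain μ (fun s => s.1) γ))
      (gaussianSender μ K) := by
  obtain ⟨hZ, hX⟩ := posDef_vecZ_and_schurCov hcov
  intro η
  have hE := hasErrorCov_gaussianSender hZ hK.1
  have hE₀ := hasErrorCov_gaussianSender (K := 0) (ny := ny) hZ zero_mem_feasible
  -- For `K = 0` the message is pure noise; an estimator based on `z` is one possible reply to it,
  -- so its error is at least the trace of the `x` block of `Ξ`.
  set γ₀ := gaussianSender μ (0 : Matrix (Fin ny) (Fin nx ⊕ Fin nw) ℝ)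
  have hle : receiverCost μ γ₀ (linearEstimator (lmsGain μ (fun s => s.1) γ₀)) ≤
      ∫⁻ s, ∫⁻ e, ‖s.1 - e‖ₑ ^ 2 ∂(η.kernel s.2.2) ∂μ := by
    refine (estimationCost_lmsGain_le isGaussian_jointLaw_gaussianSender
      (integral_jointLaw_gaussianSender hmean) isLinearMap_fst
      ⟨η.kernel.comap Prod.snd measurable_snd, inferInstance⟩).trans_eq ?_
    simp [estimationCost]
  rw [hE₀.receiverCost_eq] at hle
  refine lt_of_lt_of_le ?_ hle
  rw [hE.receiverCost_eq]
  obtain ⟨K', hK', hneg⟩ := exists_objective_neg hX δ hnx hny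
  have hobj := (hK.2 K' hK').trans_lt hneg
  rw [objective_eq] at hobj
  have hXt : (schurCov μ)ᵀ = schurCov μ := by simpa using hX.isHermitian.eq
  have hR : (schurCov μ * Kᵀ * K * schurCov μ).PosSemidef := by
    have := posSemidef_conjTranspose_mul_self (K * schurCov μ)
    rwa [conjTranspose_eq_transpose_of_trivial, transpose_mul, hXt, ← Matrix.mul_assoc] at this
  have h₂ := mul_nonneg hδ (trace_toBlocks₂₂_nonneg hR)
  have hlt : (errorCov μ K).toBlocks₁₁.trace <
      (errorCov μ (0 : Matrix (Fin ny) (Fin nx ⊕ Fin nw) ℝ)).toBlocks₁₁.trace := by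
    rw [errorCov_trace_toBlocks₁₁, errorCov, transpose_zero, Matrix.mul_zero, Matrix.zero_mul,
      sub_zero]
    linarith
  exact (ENNReal.ofReal_lt_ofReal_iff_of_nonneg (trace_toBlocks₁₁_nonneg hE.posSemidef)).mpr hlt

end Equilibrium

end PrivacyGame

open PrivacyGame

theorem theorem3 {nx nw nz ny : ℕ}
    (μ : Measure (State nx nw nz)) [IsGaussian μ]
    (hmean : ∫ s, s ∂μ = 0)
    (hcov : (secondMoment μ vecXWZ vecXWZ).PosDef)
    (δ : ℝ) (hδ : 0 ≤ δ)
    (Γ : Set (Sender nx nw nz ny))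
    (hΓ : Γ = Set.univ ∨ Γ = withoutSideInformation nx nw nz ny) :
    (minimizers μ δ ny).Nonempty ∧
    ∃ (ψ : Sender nx nw nz ny → Estimator ny nz nx)
      (φ : Sender nx nw nz ny → Estimator ny nz nw),
      (∀ γ ∈ Γ, HasFiniteSecondMoment μ γ →
        IsLinearLMS μ (fun s => s.1) γ (ψ γ) ∧ IsLinearLMS μ (fun s => s.2.1) γ (φ γ)) ∧
      ∀ K ∈ minimizers μ δ ny,
        IsEquilibrium μ δ Γ ψ φ (gaussianSender μ K) ∧
        (0 < nx → 0 < ny → IsInformative μ ψ (gaussianSender μ K)) ∧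
        HasFiniteSecondMoment μ (gaussianSender μ K) ∧
        IsUnit (obsMoment μ (gaussianSender μ K)).det ∧
        UsesGain μ (gaussianSender μ K) (ψ (gaussianSender μ K))
          (crossMoment μ (fun s => s.1) (gaussianSender μ K) *
            (obsMoment μ (gaussianSender μ K))⁻¹) ∧
        UsesGain μ (gaussianSender μ K) (φ (gaussianSender μ K))
          (crossMoment μ (fun s => s.2.1) (gaussianSender μ K) *
            (obsMoment μ (gaussianSender μ K))⁻¹) ∧
        ∀ κ : Matrix (Fin ny) (Fin ny) ℝ, κ.det ≠ 0 →
          IsEquilibrium μ δ Γ ψ φ ((gaussianSender μ K).scale κ) := by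
  obtain ⟨hZ, hX⟩ := posDef_vecZ_and_schurCov hcov
  refine ⟨minimizers_nonempty hX δ ny, fun γ => linearEstimator (lmsGain μ (fun s => s.1) γ),
    fun γ => linearEstimator (lmsGain μ (fun s => s.2.1) γ),
    fun γ _ h => ⟨isLinearLMS_lmsGain isLinearMap_fst h, isLinearLMS_lmsGain isLinearMap_snd_fst h⟩,
    fun K hK => ?_⟩
  have hG := isGaussian_jointLaw_gaussianSender (μ := μ) (K := K)
  have h0 := integral_jointLaw_gaussianSender (K := K) hmean
  have hE := hasErrorCov_gaussianSender hZ hK.1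
  have hfin := hasFiniteSecondMoment_of_isGaussian hG
  have hunit := isUnit_det_obsMoment_gaussianSender hZ hK.1
  have hmem : gaussianSender μ K ∈ Γ := by
    rcases hΓ with rfl | rfl
    · trivial
    · exact gaussianSender_mem_withoutSideInformation
  have hmem' (κ : Matrix (Fin ny) (Fin ny) ℝ) : (gaussianSender μ K).scale κ ∈ Γ := by
    rcases hΓ with rfl | rfl
    · trivial
    · exact scale_mem_withoutSideInformation gaussianSender_mem_withoutSideInformation κ
  refine ⟨isEquilibrium_of_hasErrorCov hcov hmem hG h0 hK hE,
    fun hnx hny => isInformative_of_minimizer hmean hcov hδ hnx hny hK, hfin, hunit, ?_, ?_,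
    fun κ hκ => isEquilibrium_of_hasErrorCov hcov (hmem' κ) (isGaussian_jointLaw_scale hG κ)
      (integral_jointLaw_scale hG h0 κ) hK (hE.scale hG h0 hκ)⟩
  · rw [← eq_crossMoment_mul_inv (lmsGain_mul_obsMoment isLinearMap_fst hfin) hunit]
    exact usesGain_linearEstimator _
  · rw [← eq_crossMoment_mul_inv (lmsGain_mul_obsMoment isLinearMap_snd_fst hfin) hunit]
    exact usesGain_linearEstimator _
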